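/- Setting. Let $\rho_0=dx_0\wedge dy_0$ be the standard area form of $\mathbb R^2$ and let $\mathcal J(\mathbb R^2)$ be the set of $J\in\mathrm{End}(\mathbb R^2)$ with $J^2=-1$ and $\rho_0(v,Jv)>0$ for some $v\neq 0$; put $g_J=\rho_0(\cdot,J\cdot)$. Let $\mathcal M(\mathbb R^2)$ be the bundle of pairs $(J,T)$, $J\in\mathcal J(\mathbb R^2)$, $T$ a totally symmetric $(0,4)$-tensor on $\mathbb R^2$ with $T(J\cdot,J\cdot,\cdot,\cdot)=-T$ (equivalently, of pairs $(J,q)$ with $q=T-iT(\cdot,\cdot,\cdot,J\cdot)$ a holomorphic quartic differential on the torus with complex structure $J$), and let $\mathcal{MF}(T^2)$ be the complement of its zero section. Write $U=g_J^{-1}T$, i.e. $g_J(U(X,Y)Z,W)=T(X,Y,Z,W)$, and $\langle A,B\rangle=\frac14\sum_{i,j}\mathrm{tr}\big(A(e_i,e_j)B(e_i,e_j)\big)$ for $\mathrm{End}(\mathbb R^2)$-valued bilinear forms $A,B$ and a $g_J$-orthonormal basis $(e_i)$, $\|U\|^2=\langle U,U\rangle$. For a tangent vector $(\dot J,\dot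 T)$ put $\dot U=g_J^{-1}\dot T=\dot U_0+\dot U_{\mathrm{tr}}$, the decomposition into trace-free and trace part of the endomorphism part. Let $f:[0,\infty)\to(-\infty,0]$ be smooth with $f(0)=0$ and $f'(t)<0$ for all $t\ge 0$. With $f,f'$ evaluated at $\|U\|^2/2$, set $$\mathbf g_f\big((\dot J,\dot U),(\dot J',\dot U')\big)=(1-f)\tfrac12\mathrm{tr}(\dot J\dot J')+\tfrac12 f'\big(\langle\dot U_0,\dot U_0'\rangle-\langle\dot U_{\mathrm{tr}},\dot U_{\mathrm{tr}}'\rangle\big),\qquad \boldsymbol\omega_f=\mathbf g_f(\cdot,\mathbf I\,\cdot),\qquad \mathbf I(\dot J,\dot U)=(-J\dot J,-\dot UJ-U\dot J).$$ The group $S^1$ acts on $\mathcal{MF}(T^2)$ by $e^{i\theta}\cdot(J,q)=(J,e^{-i\theta}q)$, and $\mathrm{PSL}(2,\mathbb R)$ acts by $A\cdot(J,T)=(AJA^{-1},(A^{-1})^*T)$. Theorem C. (0) The map $(z,w)\mapsto(J,T)$, where for $z=x+iy$ $$J=\begin{pmatrix}x/y&-(x^2+y^2)/y\\1/y&-x/y\end{pmatrix},\qquad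 T=\mathrm{Re}\big(\bar w(dx_0-\bar z\,dy_0)^4\big),$$ is an injective immersion of $\mathbb H^2\times\mathbb C^*$ onto $\mathcal{MF}(T^2)$; in these coordinates the two actions are $e^{i\theta}\cdot(z,w)=(z,e^{i\theta}w)$ and $\begin{pmatrix}a&b\\c&d\end{pmatrix}\cdot(z,w)=\big(\frac{az+b}{cz+d},(cz+d)^4w\big)$. The form $\boldsymbol\omega_f$ is a symplectic form on $\mathcal{MF}(T^2)$. (1) The $S^1$-action is by symplectomorphisms and is Hamiltonian for $\boldsymbol\omega_f$, with Hamiltonian (moment map) $H_1=\frac12 f(\|U\|^2/2)$, in coordinates $H_1=\frac12f(y^4|w|^2)$; moreover it is by isometries of $\mathbf g_f$. (2) The $\mathrm{PSL}(2,\mathbb R)$-action is by symplectomorphisms and is Hamiltonian for $\boldsymbol\omega_f$, with moment map $\mu_X(J,U)=\big(1-f(\|U\|^2/2)\big)\,\mathrm{tr}(JX)$, $X\in\mathfrak{sl}(2,\mathbb R)$. In particular the function $H_2=2\frac xy\big(1-f(y^4|w|^2)\big)$ equals $\mu_{\mathrm{diag}(1,-1)}$. Here an action of $G$ by symplectomorphisms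 is Hamiltonian with moment map $\mu:\mathcal{MF}(T^2)\to\mathfrak g^*$ if $\mu$ is smooth, $\mu_{g\cdot p}=\mu_p\circ\mathrm{Ad}(g^{-1})$, and $d\mu^{\xi}=\boldsymbol\omega_f(X_\xi,\cdot)$ for every $\xi\in\mathfrak g$, where $\mu^\xi(p)=\mu_p(\xi)$ and $X_\xi(p)=\frac{d}{dt}\big|_{t=0}\exp(t\xi)\cdot p$. (3) The functions $H_1,H_2$ form a completely integrable system on the four-dimensional symplectic manifold $(\mathcal{MF}(T^2),\boldsymbol\omega_f)$: their differentials are linearly independent at every point, and $\boldsymbol\omega_f(\mathbb X_{H_i},\mathbb X_{H_j})=0$, where $\boldsymbol\omega_f(\mathbb X_{H},\cdot)=dH$. Its fibres are complete: through every point the integral curves of $\mathbb X_{H_1}$ and $\mathbb X_{H_2}$ are defined for all times and remain in the fibre of $(H_1,H_2)$. (4) There are smooth angle coordinates $\theta_1:\mathcal{MF}(T^2)\to\mathbb R/2\pi\mathbb Z$ and $\theta_2:\mathcal{MF}(T^2)\to\mathbb R$ such that the set $B\subset\mathbb R^2$ of values of $(H_1,H_2)$ is open, $(\theta_1,\theta_2,H_1,H_2)$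 is a bijection of $\mathcal{MF}(T^2)$ onto $\mathbb R/2\pi\mathbb Z\times\mathbb R\times B$ with everywhere injective differential, and $\{\theta_1,H_1,\theta_2,H_2\}$ is a global Darboux frame: $$\boldsymbol\omega_f=d\theta_1\wedge dH_1+d\theta_2\wedge dH_2 .$$ -/

import Mathlib

open scoped ContDiff ComplexConjugate Matrix

noncomputable section

namespace FlatMaximal

/-! ### Symplectic notions on an open subset `D` of a real normed space `W` -/

section Symplectic

variable {W : Type*} [NormedAddCommGroup W] [NormedSpace ℝ W]

/-- `Ω` is a symplectic form on `D`: a smooth, closed, non-degenerate differential two-form. -/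
structure IsSymplecticOn (D : Set W) (Ω : W → W → W → ℝ) : Prop where
  smooth : ∀ a b : W, ContDiffOn ℝ ∞ (fun p => Ω p a b) D
  linear : ∀ p ∈ D, ∀ b : W, IsLinearMap ℝ (fun a => Ω p a b)
  antisymm : ∀ p ∈ D, ∀ a b : W, Ω p a b = -Ω p b a
  nondegenerate : ∀ p ∈ D, ∀ a : W, (∀ b : W, Ω p a b = 0) → a = 0
  closed : ∀ p ∈ D, ∀ a b c : W,
    fderiv ℝ (fun q => Ω q b c) p a + fderiv ℝ (fun q => Ω q c a) p b
      + fderiv ℝ (fun q => Ω q a b) p c = 0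

/-- The map `ψ` preserves the covariant two-tensor `τ` on `D`, that is `ψ^* τ = τ`. -/
def PreservesOn (D : Set W) (τ : W → W → W → ℝ) (ψ : W → W) : Prop :=
  ∀ p ∈ D, ∀ a b : W, τ (ψ p) (fderiv ℝ ψ p a) (fderiv ℝ ψ p b) = τ p a b

/-- `act` is an action on `D`, by diffeomorphisms of `D` that preserve `Ω`, of the group `G` whose
Lie algebra is `𝔤`, with exponential map `expG` and adjoint action `Ad`; it is Hamiltonian with
moment map `μ`. -/
structure IsHamiltonianAction {G 𝔤 : Type*} [Group G] [AddCommGroup 𝔤] [Module ℝ 𝔤]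
    (expG : 𝔤 → G) (Ad : G → 𝔤 → 𝔤) (D : Set W) (Ω : W → W → W → ℝ)
    (act : G → W → W) (μ : W → Module.Dual ℝ 𝔤) : Prop where
  mapsTo : ∀ g : G, Set.MapsTo (act g) D D
  one_act : ∀ p ∈ D, act 1 p = p
  mul_act : ∀ g h : G, ∀ p ∈ D, act (g * h) p = act g (act h p)
  smooth_act : ∀ g : G, ContDiffOn ℝ ∞ (act g) D
  symplectic : ∀ g : G, PreservesOn D Ω (act g)
  smooth_moment : ∀ X : 𝔤, ContDiffOn ℝ ∞ (fun p => μ p X) D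
  equivariant : ∀ g : G, ∀ p ∈ D, ∀ X : 𝔤, μ (act g p) X = μ p (Ad g⁻¹ X)
  generator : ∀ X : 𝔤, ∀ p ∈ D, ∃ V : W,
    HasDerivAt (fun t : ℝ => act (expG (t • X)) p) V 0 ∧
      ∀ v : W, fderiv ℝ (fun q => μ q X) p v = Ω p V v

/-- `X` is the Hamiltonian vector field of `H` on `D`: `Ω(X, ·) = dH`. -/
def IsHamiltonianVectorField (D : Set W) (Ω : W → W → W → ℝ) (H : W → ℝ) (X : W → W) : Prop :=
  ContDiffOn ℝ ∞ X D ∧ ∀ p ∈ D, ∀ v : W, Ω p (X p) v = fderiv ℝ H p v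

/-- The functions `H 0, …, H (n-1)` form a completely integrable system on the `2n`-dimensional
manifold `(D, Ω)`: their differentials are pointwise linearly independent and they are pairwise
in involution. -/
def IsCompletelyIntegrable {n : ℕ} (D : Set W) (Ω : W → W → W → ℝ) (H : Fin n → W → ℝ) : Prop :=
  Module.finrank ℝ W = 2 * n ∧
  (∀ i, ContDiffOn ℝ ∞ (H i) D) ∧
  (∀ p ∈ D, LinearIndependent ℝ (fun i => fderiv ℝ (H i) p)) ∧
  ∃ X : Fin n → W → W, (∀ i, IsHamiltonianVectorField D Ω (H i) (X i)) ∧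
    ∀ p ∈ D, ∀ i j, Ω p (X i p) (X j p) = 0

/-- The Hamiltonian vector fields of the functions `H i` are complete on every fibre of
`(H 0, …, H (n-1)) : D → ℝⁿ`. -/
def HasCompleteFibers {n : ℕ} (D : Set W) (Ω : W → W → W → ℝ) (H : Fin n → W → ℝ) : Prop :=
  ∃ X : Fin n → W → W, (∀ i, IsHamiltonianVectorField D Ω (H i) (X i)) ∧
    ∀ i, ∀ p ∈ D, ∃ γ : ℝ → W, γ 0 = p ∧
      ∀ t : ℝ, γ t ∈ D ∧ (∀ j, H j (γ t) = H j p) ∧ HasDerivAt γ (X i (γ t)) t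

/-- The differential of the angle function `θ` (with values in `ℝ / 2πℤ`) such that `e = exp (iθ)`:
`dθ = Im (ē de)`. -/
def dAngle (e : W → Circle) (p v : W) : ℝ :=
  (conj (e p : ℂ) * fderiv ℝ (fun q => (e q : ℂ)) p v).im

/-- `(θ₁, H₁, θ₂, H₂)` are global Darboux coordinates on `(D, Ω)` with angle coordinates
`θ₁ ∈ ℝ / 2πℤ` (given by `e₁ = exp (iθ₁)`) and `θ₂ ∈ ℝ`: they are smooth, have linearly independent
differentials, map `D` bijectively onto the product of `ℝ / 2πℤ × ℝ` with the (open) set of values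
of `(H₁, H₂)`, and satisfy `Ω = dθ₁ ∧ dH₁ + dθ₂ ∧ dH₂`. -/
structure IsGlobalDarbouxFrame (D : Set W) (Ω : W → W → W → ℝ)
    (e₁ : W → Circle) (H₁ θ₂ H₂ : W → ℝ) : Prop where
  smooth_angle : ContDiffOn ℝ ∞ (fun p => (e₁ p : ℂ)) D
  smooth_θ : ContDiffOn ℝ ∞ θ₂ D
  smooth_H₁ : ContDiffOn ℝ ∞ H₁ D
  smooth_H₂ : ContDiffOn ℝ ∞ H₂ D
  independent : ∀ p ∈ D, ∀ v : W, dAngle e₁ p v = 0 → fderiv ℝ H₁ p v = 0 →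
    fderiv ℝ θ₂ p v = 0 → fderiv ℝ H₂ p v = 0 → v = 0
  isOpen_base : IsOpen ((fun p => (H₁ p, H₂ p)) '' D)
  bijOn : Set.BijOn (fun p => (e₁ p, θ₂ p, (H₁ p, H₂ p))) D
    (Set.univ ×ˢ Set.univ ×ˢ ((fun p => (H₁ p, H₂ p)) '' D))
  darboux : ∀ p ∈ D, ∀ a b : W, Ω p a b =
    (dAngle e₁ p a * fderiv ℝ H₁ p b - dAngle e₁ p b * fderiv ℝ H₁ p a) +
    (fderiv ℝ θ₂ p a * fderiv ℝ H₂ p b - fderiv ℝ θ₂ p b * fderiv ℝ H₂ p a)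

end Symplectic

/-! ### Linear complex structures and quartic differentials on `ℝ²`

Tensors on `ℝ²` are given by their components in the standard basis `e₀, e₁`. -/

/-- Endomorphisms of `ℝ²`. -/
abbrev Mat2 := Matrix (Fin 2) (Fin 2) ℝ

/-- `(0,4)`-tensors on `ℝ²`: `T i j k l = T(e_i, e_j, e_k, e_l)`. -/
abbrev Tensor04 := Fin 2 → Fin 2 → Fin 2 → Fin 2 → ℝ

/-- `(1,3)`-tensors on `ℝ²`, as bilinear forms with values in endomorphisms:
`U i j = U(e_i, e_j)`. -/
abbrev Tensor13 := Fin 2 → Fin 2 → Mat2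

/-- The standard area form `dx₀ ∧ dy₀` of `ℝ²`. -/
def area (v w : Fin 2 → ℝ) : ℝ := v 0 * w 1 - v 1 * w 0

/-- The space of linear complex structures on `ℝ²` compatible with the area form. -/
def complexStructures : Set Mat2 :=
  {J | J * J = -1 ∧ ∃ v : Fin 2 → ℝ, v ≠ 0 ∧ 0 < area v (J *ᵥ v)}

/-- The Gram matrix of the scalar product `g_J = area(·, J·)`. -/
def metricOf (J : Mat2) : Mat2 :=
  Matrix.of fun i j => area (Pi.single i 1) (J *ᵥ Pi.single j 1)

/-- Totally symmetric `(0,4)`-tensors. -/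
def IsTotallySymmetric (T : Tensor04) : Prop :=
  ∀ i j k l, T i j k l = T j i k l ∧ T i j k l = T i k j l ∧ T i j k l = T i j l k

/-- The pairs `(J, T)` with `T` totally symmetric and `T(J·, J·, ·, ·) = -T`: the bundle of (real
parts of) holomorphic quartic differentials over the Teichmüller space of the torus. -/
def quarticBundle : Set (Mat2 × Tensor04) :=
  {P | P.1 ∈ complexStructures ∧ IsTotallySymmetric P.2 ∧
    ∀ i j k l, ∑ a, ∑ b, P.1 a i * P.1 b j * P.2 a b k l = -P.2 i j k l}

/-- The complement of the zero section. -/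
def modMF : Set (Mat2 × Tensor04) := {P | P ∈ quarticBundle ∧ P.2 ≠ 0}

/-- The quartic differential `q = T - i T(·, ·, ·, J·)` with real part `T`. -/
def quarticOf (P : Mat2 × Tensor04) (i j k l : Fin 2) : ℂ :=
  (P.2 i j k l : ℂ) - Complex.I * ((∑ a, P.1 a l * P.2 i j k a : ℝ) : ℂ)

/-- The circle action `(J, q) ↦ (J, e^{-iθ} q)`, at the level of `T = Re q`. -/
def circleAct (c : Circle) (P : Mat2 × Tensor04) : Mat2 × Tensor04 :=
  (P.1, fun i j k l => (conj (c : ℂ) * quarticOf P i j k l).re)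

/-- The action of `SL(2,ℝ)` by pull-back: `A · (J, T) = (A J A⁻¹, (A⁻¹)^* T)`. -/
def pullBackAct (A : Matrix.SpecialLinearGroup (Fin 2) ℝ) (P : Mat2 × Tensor04) :
    Mat2 × Tensor04 :=
  let B : Mat2 := (A⁻¹ : Matrix.SpecialLinearGroup (Fin 2) ℝ)
  ((A : Mat2) * P.1 * B, fun i j k l =>
    ∑ a, ∑ b, ∑ c, ∑ d, B a i * B b j * B c k * B d l * P.2 a b c d)

/-- `U = g_J⁻¹ T`, that is `g_J(U(X, Y) Z, W) = T(X, Y, Z, W)`. -/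
def raise (J : Mat2) (T : Tensor04) : Tensor13 :=
  fun i j => (metricOf J)⁻¹ * Matrix.of fun k l => T i j l k

/-- The scalar product on `(1,3)`-tensors: `¼ ∑ tr (A(e_i, e_j) B(e_i, e_j))` over a
`g_J`-orthonormal basis, written in an arbitrary basis. -/
def pairing (J : Mat2) (A B : Tensor13) : ℝ :=
  1 / 4 * ∑ i, ∑ j, ∑ k, ∑ l,
    (metricOf J)⁻¹ i k * (metricOf J)⁻¹ j l * Matrix.trace (A i j * B k l)

/-- The trace part of the endomorphism part of a `(1,3)`-tensor. -/
def tracePart (A : Tensor13) : Tensor13 := fun i j => (Matrix.trace (A i j) / 2) • (1 : Mat2)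

/-- The trace-free part of the endomorphism part of a `(1,3)`-tensor. -/
def tracelessPart (A : Tensor13) : Tensor13 := fun i j => A i j - tracePart A i j

/-- `‖U‖² / 2`, for the norm `‖U‖² = ⟨U, U⟩_J`. -/
def halfNormSq (J : Mat2) (U : Tensor13) : ℝ := pairing J U U / 2

/-- The bilinear form `g_f` at `(J, U)` on tangent vectors `(J̇, U̇)`. -/
def metricForm (f : ℝ → ℝ) (J : Mat2) (U : Tensor13) (a b : Mat2 × Tensor13) : ℝ :=
  (1 - f (halfNormSq J U)) * (1 / 2 * Matrix.trace (a.1 * b.1)) +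
  1 / 2 * derivWithin f (Set.Ici 0) (halfNormSq J U) *
    (pairing J (tracelessPart a.2) (tracelessPart b.2)
      - pairing J (tracePart a.2) (tracePart b.2))

/-- The complex structure `(J̇, U̇) ↦ (-J J̇, -U̇ J - U J̇)` at `(J, U)`. -/
def complexStructure (J : Mat2) (U : Tensor13) (a : Mat2 × Tensor13) : Mat2 × Tensor13 :=
  (-(J * a.1), fun i j => -(a.2 i j * J) - U i j * a.1)

/-! ### The coordinates `(z, w) ∈ ℍ² × ℂ*` -/

/-- The domain `ℍ² × ℂ*` of the global coordinates `(z, w)`. -/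
def dom : Set (ℂ × ℂ) := {p | 0 < p.1.im ∧ p.2 ≠ 0}

/-- The complex structure `j(z)` on `ℝ²` corresponding to `z = x + iy`. -/
def jCoord (p : ℂ × ℂ) : Mat2 :=
  !![p.1.re / p.1.im, -((p.1.re ^ 2 + p.1.im ^ 2) / p.1.im); 1 / p.1.im, -(p.1.re / p.1.im)]

/-- The components of the one-form `dx₀ - z̄ dy₀`. -/
def oneForm (z : ℂ) : Fin 2 → ℂ := ![1, -conj z]

/-- The real part `T` of the quartic differential `w̄ (dx₀ - z̄ dy₀)⁴`. -/
def tCoord (p : ℂ × ℂ) : Tensor04 := fun i j k l =>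
  (conj p.2 * (oneForm p.1 i * oneForm p.1 j * oneForm p.1 k * oneForm p.1 l)).re

/-- The parametrization `(z, w) ↦ (J, T)`. -/
def param (p : ℂ × ℂ) : Mat2 × Tensor04 := (jCoord p, tCoord p)

/-- The tensor `U = g_J⁻¹ T` at the point with coordinates `p`. -/
def uCoord (p : ℂ × ℂ) : Tensor13 := raise (jCoord p) (tCoord p)

/-- The variation `J̇` in the direction `a`. -/
def jDot (p a : ℂ × ℂ) : Mat2 := Matrix.of fun i j => fderiv ℝ (fun q => jCoord q i j) p a

/-- The variation `Ṫ` in the direction `a`. -/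
def tDot (p a : ℂ × ℂ) : Tensor04 := fun i j k l => fderiv ℝ (fun q => tCoord q i j k l) p a

/-- The tangent vector `(J̇, U̇)`, with `U̇ = g_J⁻¹ Ṫ`, in the direction `a`. -/
def tangent (p a : ℂ × ℂ) : Mat2 × Tensor13 := (jDot p a, raise (jCoord p) (tDot p a))

/-- The pseudo-Riemannian metric `g_f`. -/
def gForm (f : ℝ → ℝ) (p a b : ℂ × ℂ) : ℝ :=
  metricForm f (jCoord p) (uCoord p) (tangent p a) (tangent p b)

/-- The two-form `Ω_f = g_f(·, I·)`. -/
def omegaForm (f : ℝ → ℝ) (p a b : ℂ × ℂ) : ℝ :=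
  metricForm f (jCoord p) (uCoord p) (tangent p a)
    (complexStructure (jCoord p) (uCoord p) (tangent p b))

/-- Rotation of the fibres. -/
def rotAct (c : Circle) (p : ℂ × ℂ) : ℂ × ℂ := (p.1, c * p.2)

/-- `(z, w) ↦ ((az + b) / (cz + d), (cz + d)⁴ w)`. -/
def slAct (A : Matrix.SpecialLinearGroup (Fin 2) ℝ) (p : ℂ × ℂ) : ℂ × ℂ :=
  (((A 0 0 : ℝ) * p.1 + (A 0 1 : ℝ)) / ((A 1 0 : ℝ) * p.1 + (A 1 1 : ℝ)),
    ((A 1 0 : ℝ) * p.1 + (A 1 1 : ℝ)) ^ 4 * p.2)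

/-- `SL(2,ℝ)`. -/
abbrev SL2R := Matrix.SpecialLinearGroup (Fin 2) ℝ

/-- `PSL(2,ℝ) = SL(2,ℝ) / {±1}`. -/
abbrev PSL2R := Matrix.ProjectiveSpecialLinearGroup (Fin 2) ℝ

/-- The Lie algebra `𝔰𝔩(2,ℝ)` of trace-free matrices. -/
abbrev LieSL2R := LieAlgebra.SpecialLinear.sl (Fin 2) ℝ

theorem eq_or_neg_of_mk_eq {A B : SL2R} (h : (QuotientGroup.mk A : PSL2R) = QuotientGroup.mk B) :
    (B : Mat2) = A ∨ (B : Mat2) = -(A : Mat2) := by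
  rw [QuotientGroup.eq, Matrix.SpecialLinearGroup.mem_center_iff] at h
  obtain ⟨r, hr, hC⟩ := h
  have hB : (B : Mat2) = (A : Mat2) * Matrix.scalar (Fin 2) r := by
    rw [hC, ← Matrix.SpecialLinearGroup.coe_mul]
    simp
  have hr2 : r = 1 ∨ r = -1 := by simpa using hr
  rcases hr2 with rfl | rfl
  · left
    simpa using hB
  · right
    rw [hB]
    ext i j
    simp

theorem slAct_congr {A B : SL2R} (h : (QuotientGroup.mk A : PSL2R) = QuotientGroup.mk B) :
    slAct A = slAct B := by
  funext p
  rcases eq_or_neg_of_mk_eq h with h | h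
  · simp only [slAct, h]
  · simp only [slAct, h, Matrix.neg_apply, Complex.ofReal_neg]
    ext1
    · rw [show (-((A 0 0 : ℝ) : ℂ) * p.1 + -((A 0 1 : ℝ) : ℂ)) =
        -(((A 0 0 : ℝ) : ℂ) * p.1 + ((A 0 1 : ℝ) : ℂ)) by ring,
        show (-((A 1 0 : ℝ) : ℂ) * p.1 + -((A 1 1 : ℝ) : ℂ)) =
        -(((A 1 0 : ℝ) : ℂ) * p.1 + ((A 1 1 : ℝ) : ℂ)) by ring, neg_div_neg_eq]
    · ring

/-- The action of `PSL(2,ℝ)` in coordinates. -/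
def pslAct (g : PSL2R) : ℂ × ℂ → ℂ × ℂ :=
  Quotient.lift slAct (fun _ _ h => slAct_congr (Quotient.sound h)) g

/-- `X ↦ A X A⁻¹` for `A` in `SL(2,ℝ)`. -/
def slAd (A : SL2R) (X : LieSL2R) : LieSL2R :=
  ⟨(A : Mat2) * (X : Mat2) * ((A⁻¹ : SL2R) : Mat2), by
    have hX : Matrix.trace (X : Mat2) = 0 := X.2
    change Matrix.trace ((A : Mat2) * (X : Mat2) * ((A⁻¹ : SL2R) : Mat2)) = 0
    rw [Matrix.trace_mul_cycle, ← Matrix.SpecialLinearGroup.coe_mul]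
    simpa using hX⟩

theorem slAd_congr {A B : SL2R} (h : (QuotientGroup.mk A : PSL2R) = QuotientGroup.mk B) :
    slAd A = slAd B := by
  funext X
  apply Subtype.ext
  simp only [slAd, Matrix.SpecialLinearGroup.coe_inv]
  rcases eq_or_neg_of_mk_eq h with h | h
  · rw [h]
  · rw [h, Matrix.adjugate_fin_two, Matrix.adjugate_fin_two]
    ext i j
    fin_cases i <;> fin_cases j <;> simp [Matrix.mul_apply, Fin.sum_univ_two] <;> ring

/-- The adjoint action of `PSL(2,ℝ)` on its Lie algebra. -/
def pslAd (g : PSL2R) : LieSL2R → LieSL2R :=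
  Quotient.lift slAd (fun _ _ h => slAd_congr (Quotient.sound h)) g

theorem det_exp_sq (X : Mat2) (hX : Matrix.trace X = 0) : (NormedSpace.exp X).det ^ 2 = 1 := by
  have hJ : IsUnit (!![0, -1; 1, 0] : Mat2) := by
    rw [Matrix.isUnit_iff_isUnit_det]
    simp [Matrix.det_fin_two]
  have h1 : (!![0, -1; 1, 0] : Mat2) * X * (!![0, -1; 1, 0] : Mat2)⁻¹ = -Xᵀ := by
    have h0 : X 0 0 + X 1 1 = 0 := by simpa [Matrix.trace_fin_two] using hX
    have hd : (!![0, -1; 1, 0] : Mat2)⁻¹ = !![0, 1; -1, 0] :=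
      Matrix.inv_eq_right_inv (by ext i j; fin_cases i <;> fin_cases j <;> simp)
    rw [hd, Matrix.eta_fin_two X]
    ext i j
    fin_cases i <;> fin_cases j <;> simp <;> linarith
  have h2 := Matrix.exp_conj (!![0, -1; 1, 0] : Mat2) X hJ
  rw [h1, Matrix.exp_neg, Matrix.exp_transpose] at h2
  have h3 := congrArg Matrix.det h2
  rw [Matrix.det_conj hJ, Matrix.det_nonsing_inv, Matrix.det_transpose] at h3
  have hu : IsUnit (NormedSpace.exp X).det :=
    (Matrix.isUnit_iff_isUnit_det _).mp (Matrix.isUnit_exp X)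
  rw [Ring.inverse_eq_inv'] at h3
  rw [sq]
  nth_rewrite 1 [← h3]
  exact inv_mul_cancel₀ hu.ne_zero

theorem det_exp_eq_one (X : Mat2) (hX : Matrix.trace X = 0) : (NormedSpace.exp X).det = 1 := by
  have h := Matrix.exp_nsmul 2 ((1 / 2 : ℝ) • X)
  have e : (2 : ℕ) • ((1 / 2 : ℝ) • X) = X := by
    ext i j
    simp
  rw [e] at h
  rw [h, Matrix.det_pow]
  exact det_exp_sq _ (by rw [Matrix.trace_smul, hX, smul_zero])

/-- The exponential map of `PSL(2,ℝ)`, induced by the matrix exponential. -/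
def pslExp (X : LieSL2R) : PSL2R :=
  QuotientGroup.mk (⟨NormedSpace.exp (X : Mat2), det_exp_eq_one _ X.2⟩ : SL2R)

/-! ### Hamiltonians and moment maps -/

/-- `H₁ = f(‖U‖² / 2) / 2`. -/
def H₁ (f : ℝ → ℝ) (p : ℂ × ℂ) : ℝ := f (halfNormSq (jCoord p) (uCoord p)) / 2

/-- `H₂ = 2 (x / y) (1 - f(y⁴ |w|²))`. -/
def H₂ (f : ℝ → ℝ) (p : ℂ × ℂ) : ℝ :=
  2 * (p.1.re / p.1.im) * (1 - f (p.1.im ^ 4 * ‖p.2‖ ^ 2))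

/-- The map with values in the dual of `Lie(S¹) = ℝ` corresponding to `H₁`. -/
def circleMoment (f : ℝ → ℝ) (p : ℂ × ℂ) : Module.Dual ℝ ℝ := H₁ f p • LinearMap.id

/-- `μ_X = (1 - f(‖U‖² / 2)) tr (J X)`. -/
def pslMoment (f : ℝ → ℝ) (p : ℂ × ℂ) : Module.Dual ℝ LieSL2R where
  toFun X := (1 - f (halfNormSq (jCoord p) (uCoord p))) * Matrix.trace (jCoord p * (X : Mat2))
  map_add' X Y := by
    simp [mul_add]
  map_smul' c X := by
    simp [mul_left_comm]

/-- The matrix `diag(1, -1)`. -/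
def diagElement : LieSL2R :=
  ⟨!![1, 0; 0, -1], by
    change Matrix.trace (!![1, 0; 0, -1] : Mat2) = 0
    simp [Matrix.trace_fin_two]⟩

/-- `(z, w) ↦ (J, T)` identifies `ℍ² × ℂ*` with the complement of the zero section, and the two
actions in coordinates with the rotation of the fibres and the action by pull-back. -/
structure IsParametrization : Prop where
  bijOn : Set.BijOn param dom modMF
  immersion : ∀ p ∈ dom, ∀ a : ℂ × ℂ, jDot p a = 0 → tDot p a = 0 → a = 0
  rotAct_eq : ∀ c : Circle, ∀ p ∈ dom, param (rotAct c p) = circleAct c (param p)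
  pslAct_eq : ∀ A : SL2R, ∀ p ∈ dom, param (pslAct (QuotientGroup.mk A) p) = pullBackAct A (param p)

end FlatMaximal

end

open FlatMaximal

open scoped ContDiff ComplexConjugate Matrix

noncomputable section

namespace FlatMaximal

/-! In the coordinates `(z, w)` the complex structure is multiplication by `i`: the quartic
differential `q = w̄ (dx₀ - z̄ dy₀)⁴` is antiholomorphic in `(z, w)` and satisfies `q(·, ·, ·, J·) =
i q` (`tangent_I`). Put `s = y⁴|w|²` and `ζ = dw/w - 2i dz/y` (`logDiff`), so that `ds = 2 s Re ζ`.
Evaluating the tensors on a `g_J`-orthogonal frame gives `g_f = (1 - f)|dz|²/y² + s f' |ζ|²`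
(`gForm_eq`), hence `Ω_f = -(1 - f) dx∧dy/y² - s f' Re ζ ∧ Im ζ` (`omegaForm_eq`).

Both actions preserve `s`, `ζ` and the hyperbolic area form, hence `Ω_f`. Their generators have
purely imaginary `ζ`, because `s` is invariant, and contracting `Ω_f` with them gives exact forms
(`omegaForm_rotField`, `fderiv_pslMoment`).

Since `dH₁ = s f' Re ζ`, one has `Ω_f = Im ζ ∧ dH₁ + (1 - f) d log y ∧ d(x/y)`. Substituting `(1 -
f) d(x/y) = ½ dH₂ + 2 (x/y) dH₁` and moving the last term into the first summand turns `Im ζ` into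
`d(arg w - 2x/y)`. This gives the Darboux form with `θ₁ = arg w - 2x/y` and `θ₂ = ½ log y`
(`omegaForm_eq_darboux`). Closedness and non-degeneracy are read off from this frame. The signs `f'
< 0` and `1 - f > 0` make `(s, x/y)` and `(H₁, H₂)` determine each other. The Hamiltonian flows are
the rotations of `w` and the dilations `(e^{2t} z, e^{-4t} w)`, which are complete. -/

theorem isOpen_dom : IsOpen dom :=
  (isOpen_lt continuous_const (Complex.continuous_im.comp continuous_fst)).inter
    (isOpen_ne_fun continuous_snd continuous_const)

/-! ### The variations of `J` and `T` in coordinates -/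

theorem hasFDerivAt_re (p : ℂ × ℂ) :
    HasFDerivAt (fun q : ℂ × ℂ => q.1.re)
      (Complex.reCLM.comp (ContinuousLinearMap.fst ℝ ℂ ℂ)) p :=
  (Complex.reCLM.comp (ContinuousLinearMap.fst ℝ ℂ ℂ)).hasFDerivAt

theorem hasFDerivAt_im (p : ℂ × ℂ) :
    HasFDerivAt (fun q : ℂ × ℂ => q.1.im)
      (Complex.imCLM.comp (ContinuousLinearMap.fst ℝ ℂ ℂ)) p :=
  (Complex.imCLM.comp (ContinuousLinearMap.fst ℝ ℂ ℂ)).hasFDerivAt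

theorem HasFDerivAt.real_div {E : Type*} [NormedAddCommGroup E] [NormedSpace ℝ E] {g h : E → ℝ}
    {g' h' : E →L[ℝ] ℝ} {p : E} (hg : HasFDerivAt g g' p) (hh : HasFDerivAt h h' p)
    (h0 : h p ≠ 0) :
    HasFDerivAt (fun q => g q / h q) ((h p)⁻¹ • g' - (g p / h p ^ 2) • h') p := by
  refine (hg.mul ((hasDerivAt_inv h0).comp_hasFDerivAt p hh)).congr_fderiv ?_
  ext v
  simp
  ring

theorem jDot_eq {p : ℂ × ℂ} (hp : 0 < p.1.im) (a : ℂ × ℂ) :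
    jDot p a = !![a.1.re / p.1.im - p.1.re * a.1.im / p.1.im ^ 2,
      -(2 * p.1.re * a.1.re / p.1.im - p.1.re ^ 2 * a.1.im / p.1.im ^ 2 + a.1.im);
      -(a.1.im / p.1.im ^ 2), -(a.1.re / p.1.im - p.1.re * a.1.im / p.1.im ^ 2)] := by
  have hy : p.1.im ≠ 0 := hp.ne'
  have hx := hasFDerivAt_re p
  have hi := hasFDerivAt_im p
  have h00 := HasFDerivAt.real_div hx hi hy
  have h01 := (HasFDerivAt.real_div ((hx.pow 2).fun_add (hi.pow 2)) hi hy).fun_neg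
  have h10 := HasFDerivAt.real_div (hasFDerivAt_const (1 : ℝ) p) hi hy
  have h11 := h00.fun_neg
  ext i j
  fin_cases i <;> fin_cases j
  · refine (congrArg (· a) h00.fderiv).trans ?_
    simp; field_simp
  · refine (congrArg (· a) h01.fderiv).trans ?_
    simp; field_simp; ring
  · refine (congrArg (· a) h10.fderiv).trans ?_
    simp; ring
  · refine (congrArg (· a) h11.fderiv).trans ?_
    simp; field_simp

/-- The variation of `dx₀ - z̄ dy₀`. -/
def oneFormDot (ζ : ℂ) : Fin 2 → ℂ := ![0, -conj ζ]

/-- The variation of the quartic differential `w̄ (dx₀ - z̄ dy₀)⁴`. -/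
def quarticDot (p a : ℂ × ℂ) (i j k l : Fin 2) : ℂ :=
  conj a.2 * (oneForm p.1 i * oneForm p.1 j * oneForm p.1 k * oneForm p.1 l) +
  conj p.2 * (oneFormDot a.1 i * oneForm p.1 j * oneForm p.1 k * oneForm p.1 l +
    oneForm p.1 i * oneFormDot a.1 j * oneForm p.1 k * oneForm p.1 l +
    oneForm p.1 i * oneForm p.1 j * oneFormDot a.1 k * oneForm p.1 l +
    oneForm p.1 i * oneForm p.1 j * oneForm p.1 k * oneFormDot a.1 l)

theorem hasFDerivAt_oneForm (p : ℂ × ℂ) (i : Fin 2) :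
    ∃ L : ℂ × ℂ →L[ℝ] ℂ, HasFDerivAt (fun q : ℂ × ℂ => oneForm q.1 i) L p ∧
      ∀ a, L a = oneFormDot a.1 i := by
  fin_cases i
  · exact ⟨0, hasFDerivAt_const _ _, fun a => by simp [oneFormDot]⟩
  · exact ⟨-((Complex.conjCLE : ℂ →L[ℝ] ℂ).comp (ContinuousLinearMap.fst ℝ ℂ ℂ)),
      (((Complex.conjCLE : ℂ →L[ℝ] ℂ).comp (ContinuousLinearMap.fst ℝ ℂ ℂ)).hasFDerivAt).neg,
      fun a => by simp [oneFormDot]⟩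

theorem tDot_eq (p a : ℂ × ℂ) (i j k l : Fin 2) :
    tDot p a i j k l = (quarticDot p a i j k l).re := by
  obtain ⟨Li, hi, hi'⟩ := hasFDerivAt_oneForm p i
  obtain ⟨Lj, hj, hj'⟩ := hasFDerivAt_oneForm p j
  obtain ⟨Lk, hk, hk'⟩ := hasFDerivAt_oneForm p k
  obtain ⟨Ll, hl, hl'⟩ := hasFDerivAt_oneForm p l
  have hw : HasFDerivAt (fun q : ℂ × ℂ => conj q.2) _ p :=
    ((Complex.conjCLE : ℂ →L[ℝ] ℂ).comp (ContinuousLinearMap.snd ℝ ℂ ℂ)).hasFDerivAt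
  have h := Complex.reCLM.hasFDerivAt.comp p
    (hw.fun_mul (((hi.fun_mul hj).fun_mul hk).fun_mul hl))
  refine (congrArg (· a) h.fderiv).trans ?_
  simp only [ContinuousLinearMap.comp_apply, _root_.add_apply,
    _root_.smul_apply, hi', hj', hk', hl', smul_eq_mul, Complex.reCLM_apply,
    ContinuousLinearMap.coe_snd', ContinuousLinearEquiv.coe_coe, Complex.conjCLE_apply]
  congr 1
  simp only [quarticDot]
  ring

/-! ### Multiplication by `i` -/

/-- The form `dx₀ - z̄ dy₀` kills `z̄ e₀ + e₁`, the `-i`-eigenvector of `j(z)`, so it is of type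
(1,0). -/
theorem oneForm_comp_jCoord {p : ℂ × ℂ} (hp : 0 < p.1.im) (l : Fin 2) :
    ∑ a, (jCoord p a l : ℂ) * oneForm p.1 a = Complex.I * oneForm p.1 l := by
  have hy : p.1.im ≠ 0 := hp.ne'
  apply Complex.ext <;>
    simp only [Fin.sum_univ_two, Complex.add_re, Complex.add_im, Complex.re_ofReal_mul,
      Complex.im_ofReal_mul] <;>
    fin_cases l <;> simp [jCoord, oneForm] <;> field_simp <;> ring

theorem oneForm_comp_jDot {p : ℂ × ℂ} (hp : 0 < p.1.im) (a : ℂ × ℂ) (l : Fin 2) :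
    ∑ b, ((jDot p a b l : ℂ) * oneForm p.1 b + (jCoord p b l : ℂ) * oneFormDot a.1 b) =
      Complex.I * oneFormDot a.1 l := by
  have hy : p.1.im ≠ 0 := hp.ne'
  rw [jDot_eq hp]
  apply Complex.ext <;>
    simp only [Fin.sum_univ_two, Complex.add_re, Complex.add_im, Complex.re_ofReal_mul,
      Complex.im_ofReal_mul] <;>
    fin_cases l <;> simp [jCoord, oneForm, oneFormDot] <;> field_simp <;> ring

/-- This is the derivative of `q(·, ·, J·, ·) = i q`. The third slot is used because it is the
endomorphism argument of `U`, on which `complexStructure` composes with `J` and `J̇`. -/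
theorem quarticDot_comp {p : ℂ × ℂ} (hp : 0 < p.1.im) (b : ℂ × ℂ) (i j k l : Fin 2) :
    ∑ m, (quarticDot p b i j m k * (jCoord p m l : ℂ) +
      conj p.2 * (oneForm p.1 i * oneForm p.1 j * oneForm p.1 m * oneForm p.1 k) *
        (jDot p b m l : ℂ)) = Complex.I * quarticDot p b i j l k := by
  have h1 := oneForm_comp_jCoord hp l
  have h2 := oneForm_comp_jDot hp b l
  simp only [Fin.sum_univ_two, quarticDot] at *
  linear_combination (conj b.2 * (oneForm p.1 i * oneForm p.1 j * oneForm p.1 k) +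
    conj p.2 * (oneFormDot b.1 i * oneForm p.1 j * oneForm p.1 k +
      oneForm p.1 i * oneFormDot b.1 j * oneForm p.1 k +
      oneForm p.1 i * oneForm p.1 j * oneFormDot b.1 k)) * h1 +
    conj p.2 * (oneForm p.1 i * oneForm p.1 j * oneForm p.1 k) * h2

/-- Only `z̄` and `w̄` enter `q`, so its differential is conjugate-linear. -/
theorem quarticDot_I (p b : ℂ × ℂ) (i j k l : Fin 2) :
    quarticDot p (Complex.I * b.1, Complex.I * b.2) i j k l =
      -(Complex.I * quarticDot p b i j k l) := by
  have h : ∀ i, oneFormDot (Complex.I * b.1) i = -(Complex.I * oneFormDot b.1 i) := by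
    intro i
    fin_cases i <;> simp [oneFormDot]
  simp only [quarticDot, h, map_mul, Complex.conj_I]
  ring

theorem jDot_I {p : ℂ × ℂ} (hp : 0 < p.1.im) (b : ℂ × ℂ) :
    jDot p (Complex.I * b.1, Complex.I * b.2) = -(jCoord p * jDot p b) := by
  have hy : p.1.im ≠ 0 := hp.ne'
  rw [jDot_eq hp, jDot_eq hp, jCoord]
  ext i j
  fin_cases i <;> fin_cases j <;> simp <;> field_simp <;> ring

/-- In the coordinates `(z, w)` the complex structure is the multiplication by `i`. -/
theorem tangent_I {p : ℂ × ℂ} (hp : 0 < p.1.im) (b : ℂ × ℂ) :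
    tangent p (Complex.I * b.1, Complex.I * b.2) =
      complexStructure (jCoord p) (uCoord p) (tangent p b) := by
  refine Prod.ext (jDot_I hp b) ?_
  funext i j
  simp only [tangent, complexStructure, uCoord, raise]
  rw [Matrix.mul_assoc, Matrix.mul_assoc, ← Matrix.mul_neg, ← Matrix.mul_sub]
  congr 1
  ext k l
  -- The real part reads `Ṫ(J·) + T(J̇·) = Re(i q̇)`, the opposite of the variation of `T` in the
  -- direction `i b`.
  have h := congrArg Complex.re (quarticDot_comp hp b i j k l)
  simp only [Fin.sum_univ_two, Complex.add_re, Complex.re_mul_ofReal] at h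
  simp only [Matrix.of_apply, Matrix.sub_apply, Matrix.neg_apply, Matrix.mul_apply,
    Fin.sum_univ_two, tDot_eq, quarticDot_I, tCoord, Complex.neg_re]
  linarith

/-! ### The scalar product of symmetric tensors -/

/-- With `v = x e₀ + e₁ = y J e₀`, the inverse metric is `y e₀ ⊗ e₀ + y⁻¹ v ⊗ v`. Every contraction
below therefore splits into evaluations on `e₀` and on `v`, and `slot` performs the latter. -/
theorem metricOf_jCoord_inv {p : ℂ × ℂ} (hp : 0 < p.1.im) :
    (metricOf (jCoord p))⁻¹ = !![(p.1.re ^ 2 + p.1.im ^ 2) / p.1.im, p.1.re / p.1.im;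
      p.1.re / p.1.im, 1 / p.1.im] := by
  have hy : p.1.im ≠ 0 := hp.ne'
  apply Matrix.inv_eq_right_inv
  ext i j
  fin_cases i <;> fin_cases j <;>
    simp [metricOf, area, jCoord, Matrix.mul_apply, Fin.sum_univ_two] <;>
    field_simp <;> ring

/-- The symmetric tensor whose value on `n` copies of `e₁` and `4 - n` copies of `e₀` is `s n`. -/
def symTensor (s : ℕ → ℝ) : Tensor04 := fun i j k l => s (i + j + k + l)

/-- The evaluation of one slot of a symmetric tensor on `x e₀ + e₁`. -/
def slot (x : ℝ) (s : ℕ → ℝ) (n : ℕ) : ℝ := s (n + 1) + x * s n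

theorem trace_raise_mul_raise {p : ℂ × ℂ} (hp : 0 < p.1.im) (s s' : ℕ → ℝ) (i j k l : Fin 2) :
    Matrix.trace (raise (jCoord p) (symTensor s) i j * raise (jCoord p) (symTensor s') k l) =
      p.1.im ^ 2 * (s (i + j) * s' (k + l)) +
      2 * (slot p.1.re s (i + j) * slot p.1.re s' (k + l)) +
      slot p.1.re (slot p.1.re s) (i + j) * slot p.1.re (slot p.1.re s') (k + l) /
        p.1.im ^ 2 := by
  have hy : p.1.im ≠ 0 := hp.ne'
  simp only [raise, metricOf_jCoord_inv hp, symTensor, slot, Matrix.trace_fin_two,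
    Matrix.mul_apply, Fin.sum_univ_two, Matrix.of_apply, Matrix.cons_val', Matrix.cons_val_zero,
    Matrix.cons_val_one, Matrix.cons_val_fin_one, Fin.val_zero, Fin.val_one]
  generalize (i : ℕ) + (j : ℕ) = n
  generalize (k : ℕ) + (l : ℕ) = m
  simp only [add_zero]
  field_simp
  ring

theorem trace_raise {p : ℂ × ℂ} (hp : 0 < p.1.im) (s : ℕ → ℝ) (i j : Fin 2) :
    Matrix.trace (raise (jCoord p) (symTensor s) i j) =
      p.1.im * s (i + j) + slot p.1.re (slot p.1.re s) (i + j) / p.1.im := by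
  have hy : p.1.im ≠ 0 := hp.ne'
  simp only [raise, metricOf_jCoord_inv hp, symTensor, slot, Matrix.trace_fin_two,
    Matrix.mul_apply, Fin.sum_univ_two, Matrix.of_apply, Matrix.cons_val', Matrix.cons_val_zero,
    Matrix.cons_val_one, Matrix.cons_val_fin_one, Fin.val_zero, Fin.val_one]
  generalize (i : ℕ) + (j : ℕ) = n
  simp only [add_zero]
  field_simp
  ring

theorem sum_metric_mul {p : ℂ × ℂ} (hp : 0 < p.1.im) (s s' : ℕ → ℝ) :
    ∑ i : Fin 2, ∑ j : Fin 2, ∑ k : Fin 2, ∑ l : Fin 2,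
      (metricOf (jCoord p))⁻¹ i k * (metricOf (jCoord p))⁻¹ j l * (s (i + j) * s' (k + l)) =
      p.1.im ^ 2 * (s 0 * s' 0) + 2 * (slot p.1.re s 0 * slot p.1.re s' 0) +
      slot p.1.re (slot p.1.re s) 0 * slot p.1.re (slot p.1.re s') 0 / p.1.im ^ 2 := by
  have hy : p.1.im ≠ 0 := hp.ne'
  simp only [metricOf_jCoord_inv hp, slot, Fin.sum_univ_two, Matrix.of_apply, Matrix.cons_val',
    Matrix.cons_val_zero, Matrix.cons_val_one, Matrix.cons_val_fin_one, Fin.val_zero, Fin.val_one,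
    zero_add, add_zero, Nat.reduceAdd]
  field_simp
  ring

/-- Here `t n` is the value on `4 - n` copies of `e₀` and `n` copies of `x e₀ + e₁`. It occurs once
for each choice of `n` slots among four, whence the binomial coefficients, with weight `y^(4 - 2n)`.
-/
theorem pairing_raise {p : ℂ × ℂ} (hp : 0 < p.1.im) (s s' : ℕ → ℝ) {t t' : ℕ → ℝ}
    (ht : ∀ n, t n = (slot p.1.re)^[n] s 0) (ht' : ∀ n, t' n = (slot p.1.re)^[n] s' 0) :
    pairing (jCoord p) (raise (jCoord p) (symTensor s)) (raise (jCoord p) (symTensor s')) =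
    1 / 4 * (p.1.im ^ 4 * (t 0 * t' 0) + 4 * p.1.im ^ 2 * (t 1 * t' 1) + 6 * (t 2 * t' 2) +
      4 * (t 3 * t' 3) / p.1.im ^ 2 + t 4 * t' 4 / p.1.im ^ 4) := by
  have hy : p.1.im ≠ 0 := hp.ne'
  have h0 := sum_metric_mul hp s s'
  have h1 := sum_metric_mul hp (slot p.1.re s) (slot p.1.re s')
  have h2 := sum_metric_mul hp (slot p.1.re (slot p.1.re s)) (slot p.1.re (slot p.1.re s'))
  -- Two contractions come from the trace and two from the metric; the placeholders are the
  -- right-hand sides of `h0`, `h1`, `h2`.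
  have e : pairing (jCoord p) (raise (jCoord p) (symTensor s)) (raise (jCoord p) (symTensor s')) =
      1 / 4 * (p.1.im ^ 2 * _ + 2 * _ + _ / p.1.im ^ 2) :=
    Eq.trans ?_ (congrArg (1 / 4 * ·) (congrArg₂ (· + ·) (congrArg₂ (· + ·)
      (congrArg (p.1.im ^ 2 * ·) h0) (congrArg (2 * ·) h1)) (congrArg (· / p.1.im ^ 2) h2)))
  · rw [e]
    simp only [ht, ht', Function.iterate_succ_apply, Function.iterate_zero_apply]
    field_simp
    ring
  · simp only [pairing, trace_raise_mul_raise hp, Finset.mul_sum, Finset.sum_div,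
      ← Finset.sum_add_distrib]
    refine Finset.sum_congr rfl fun i _ => Finset.sum_congr rfl fun j _ =>
      Finset.sum_congr rfl fun k _ => Finset.sum_congr rfl fun l _ => ?_
    ring

theorem pairing_tracePart (J : Mat2) (A B : Tensor13) :
    pairing J (tracePart A) (tracePart B) = 1 / 8 * ∑ i, ∑ j, ∑ k, ∑ l,
      (metricOf J)⁻¹ i k * (metricOf J)⁻¹ j l *
        (Matrix.trace (A i j) * Matrix.trace (B k l)) := by
  simp only [pairing, tracePart, Finset.mul_sum]
  refine Finset.sum_congr rfl fun i _ => Finset.sum_congr rfl fun j _ =>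
    Finset.sum_congr rfl fun k _ => Finset.sum_congr rfl fun l _ => ?_
  simp
  ring

/-- Scalar and trace-free matrices are orthogonal for the trace form. -/
theorem pairing_tracelessPart (J : Mat2) (A B : Tensor13) :
    pairing J (tracelessPart A) (tracelessPart B) =
      pairing J A B - pairing J (tracePart A) (tracePart B) := by
  rw [pairing_tracePart]
  simp only [pairing, tracelessPart, tracePart, Finset.mul_sum, ← Finset.sum_sub_distrib]
  refine Finset.sum_congr rfl fun i _ => Finset.sum_congr rfl fun j _ =>
    Finset.sum_congr rfl fun k _ => Finset.sum_congr rfl fun l _ => ?_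
  simp [Matrix.sub_mul, Matrix.mul_sub]
  ring

theorem pairing_tracePart_raise {p : ℂ × ℂ} (hp : 0 < p.1.im) (s s' : ℕ → ℝ) {t t' : ℕ → ℝ}
    (ht : ∀ n, t n = (slot p.1.re)^[n] s 0) (ht' : ∀ n, t' n = (slot p.1.re)^[n] s' 0) :
    pairing (jCoord p) (tracePart (raise (jCoord p) (symTensor s)))
      (tracePart (raise (jCoord p) (symTensor s'))) =
    1 / 8 * (p.1.im ^ 2 * ((p.1.im * t 0 + t 2 / p.1.im) * (p.1.im * t' 0 + t' 2 / p.1.im)) +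
      2 * ((p.1.im * t 1 + t 3 / p.1.im) * (p.1.im * t' 1 + t' 3 / p.1.im)) +
      (p.1.im * t 2 + t 4 / p.1.im) * (p.1.im * t' 2 + t' 4 / p.1.im) / p.1.im ^ 2) := by
  have h0 := sum_metric_mul hp
    (fun n => p.1.im * s n + slot p.1.re (slot p.1.re s) n / p.1.im)
    (fun n => p.1.im * s' n + slot p.1.re (slot p.1.re s') n / p.1.im)
  have h : ∀ s : ℕ → ℝ, slot p.1.re
      (fun n => p.1.im * s n + slot p.1.re (slot p.1.re s) n / p.1.im) =
      fun n => p.1.im * slot p.1.re s n + slot p.1.re (slot p.1.re (slot p.1.re s)) n / p.1.im := by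
    intro s
    funext n
    simp only [slot]
    ring
  simp only [h] at h0
  simp only [pairing_tracePart, trace_raise hp, h0, ht, ht', Function.iterate_succ_apply,
    Function.iterate_zero_apply]

/-! ### Components of `T` and `Ṫ` in the adapted frame -/

/-- The components of `T` on copies of `e₀` and `e₁`. -/
def tComp (p : ℂ × ℂ) (n : ℕ) : ℝ := (conj p.2 * (-conj p.1) ^ n).re

/-- The components of `Ṫ` on copies of `e₀` and `e₁`. -/
def tDotComp (p a : ℂ × ℂ) (n : ℕ) : ℝ :=
  (conj a.2 * (-conj p.1) ^ n - n * (conj p.2 * conj a.1 * (-conj p.1) ^ (n - 1))).re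

theorem tCoord_eq_symTensor (p : ℂ × ℂ) : tCoord p = symTensor (tComp p) := by
  funext i j k l
  simp only [tCoord, symTensor, tComp]
  congr 2
  fin_cases i <;> fin_cases j <;> fin_cases k <;> fin_cases l <;> simp [oneForm] <;> ring

theorem tDot_eq_symTensor (p a : ℂ × ℂ) : tDot p a = symTensor (tDotComp p a) := by
  funext i j k l
  simp only [tDot_eq, symTensor, tDotComp]
  congr 1
  simp only [quarticDot]
  fin_cases i <;> fin_cases j <;> fin_cases k <;> fin_cases l <;>
    simp [oneForm, oneFormDot] <;> ring

/-- The form `dx₀ - z̄ dy₀` takes the value `1` on `e₀` and `x - z̄ = iy` on `x e₀ + e₁`. -/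
theorem slot_tComp (p : ℂ × ℂ) (n : ℕ) :
    (slot p.1.re)^[n] (tComp p) 0 = (conj p.2 * (Complex.I * p.1.im) ^ n).re := by
  have h : ∀ n k, (slot p.1.re)^[n] (tComp p) k =
      (conj p.2 * (Complex.I * p.1.im) ^ n * (-conj p.1) ^ k).re := by
    intro n
    induction n with
    | zero => simp [tComp]
    | succ n ih =>
      intro k
      rw [Function.iterate_succ_apply', slot, ih, ih, ← Complex.re_ofReal_mul, ← Complex.add_re]
      congr 1
      have : Complex.I * (p.1.im : ℂ) = (p.1.re : ℂ) - conj p.1 := by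
        simp [Complex.ext_iff]
      linear_combination
        -(conj p.2 * (Complex.I * p.1.im) ^ n * (-conj p.1) ^ k) * this
  simpa using h n 0

/-- Leibniz rule for the formal derivative of `r^(k+1)`; at `k = 0` the truncated exponent `k - 1`
is harmless because of the factor `k`. -/
theorem cast_mul_pow_pred_succ (r : ℂ) (k : ℕ) :
    ((k + 1 : ℕ) : ℂ) * r ^ (k + 1 - 1) = r * (k * r ^ (k - 1)) + r ^ k := by
  cases k with
  | zero => simp
  | succ k =>
    push_cast
    ring

theorem slot_tDotComp (p a : ℂ × ℂ) (n : ℕ) :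
    (slot p.1.re)^[n] (tDotComp p a) 0 = (conj a.2 * (Complex.I * p.1.im) ^ n -
      conj p.2 * conj a.1 * (n * (Complex.I * p.1.im) ^ (n - 1))).re := by
  have h : ∀ n k, (slot p.1.re)^[n] (tDotComp p a) k =
      (conj a.2 * (Complex.I * p.1.im) ^ n * (-conj p.1) ^ k - conj p.2 * conj a.1 *
        (n * (Complex.I * p.1.im) ^ (n - 1) * (-conj p.1) ^ k +
          (Complex.I * p.1.im) ^ n * (k * (-conj p.1) ^ (k - 1)))).re := by
    intro n
    induction n with
    | zero =>
      intro k
      simp only [Function.iterate_zero_apply, tDotComp]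
      congr 1
      push_cast
      ring
    | succ n ih =>
      intro k
      rw [Function.iterate_succ_apply', slot, ih, ih, ← Complex.re_ofReal_mul, ← Complex.add_re]
      congr 1
      have : Complex.I * (p.1.im : ℂ) = (p.1.re : ℂ) - conj p.1 := by
        simp [Complex.ext_iff]
      rw [cast_mul_pow_pred_succ, cast_mul_pow_pred_succ]
      linear_combination
        -(conj a.2 * (Complex.I * p.1.im) ^ n * (-conj p.1) ^ k - conj p.2 * conj a.1 *
        (n * (Complex.I * p.1.im) ^ (n - 1) * (-conj p.1) ^ k +
          (Complex.I * p.1.im) ^ n * (k * (-conj p.1) ^ (k - 1)))) * this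
  simpa using h n 0

theorem halfNormSq_uCoord {p : ℂ × ℂ} (hp : 0 < p.1.im) :
    halfNormSq (jCoord p) (uCoord p) = p.1.im ^ 4 * ‖p.2‖ ^ 2 := by
  have hy : p.1.im ≠ 0 := hp.ne'
  rw [halfNormSq, uCoord, tCoord_eq_symTensor, pairing_raise hp _ _
    (fun n => (slot_tComp p n).symm) (fun n => (slot_tComp p n).symm), ← Complex.normSq_eq_norm_sq,
    Complex.normSq_apply]
  simp [pow_succ]
  field_simp
  ring

/-! ### The metric and the two-form in coordinates -/

/-- The logarithmic differential of the quartic differential in the direction `a`, with respect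
to the Chern connection. -/
def logDiff (p a : ℂ × ℂ) : ℂ := a.2 / p.2 - 2 * Complex.I * a.1 / p.1.im

theorem gForm_eq (f : ℝ → ℝ) {p : ℂ × ℂ} (hp : p ∈ dom) (a b : ℂ × ℂ) :
    gForm f p a b =
      (1 - f (p.1.im ^ 4 * ‖p.2‖ ^ 2)) * (conj a.1 * b.1).re / p.1.im ^ 2 +
      derivWithin f (Set.Ici 0) (p.1.im ^ 4 * ‖p.2‖ ^ 2) * (p.1.im ^ 4 * ‖p.2‖ ^ 2) *
        (conj (logDiff p a) * logDiff p b).re := by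
  have hy : p.1.im ≠ 0 := hp.1.ne'
  have hw : p.2 ≠ 0 := hp.2
  have hJ : 1 / 2 * Matrix.trace (jDot p a * jDot p b) = (conj a.1 * b.1).re / p.1.im ^ 2 := by
    rw [jDot_eq hp.1, jDot_eq hp.1]
    simp [Matrix.trace_fin_two]
    field_simp
    ring
  -- By orthogonality, trace-free part minus trace part equals the full pairing minus twice the
  -- trace part.
  have hT : 1 / 2 * (pairing (jCoord p) (raise (jCoord p) (tDot p a))
      (raise (jCoord p) (tDot p b)) - 2 * pairing (jCoord p)
        (tracePart (raise (jCoord p) (tDot p a))) (tracePart (raise (jCoord p) (tDot p b)))) =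
      p.1.im ^ 4 * ((conj a.2 + 2 * Complex.I * conj a.1 * conj p.2 / p.1.im) *
        (b.2 - 2 * Complex.I * b.1 * p.2 / p.1.im)).re := by
    rw [tDot_eq_symTensor, tDot_eq_symTensor, pairing_raise hp.1 _ _
      (fun n => (slot_tDotComp p a n).symm) (fun n => (slot_tDotComp p b n).symm),
      pairing_tracePart_raise hp.1 _ _
      (fun n => (slot_tDotComp p a n).symm) (fun n => (slot_tDotComp p b n).symm)]
    simp [pow_succ, Complex.div_re, Complex.div_im, Complex.normSq_apply]
    field_simp
    ring
  have hζ : p.1.im ^ 4 * ‖p.2‖ ^ 2 * (conj (logDiff p a) * logDiff p b).re =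
      p.1.im ^ 4 * ((conj a.2 + 2 * Complex.I * conj a.1 * conj p.2 / p.1.im) *
        (b.2 - 2 * Complex.I * b.1 * p.2 / p.1.im)).re := by
    have hw' : conj p.2 ≠ 0 := by simpa using hw
    have hyc : (p.1.im : ℂ) ≠ 0 := by exact_mod_cast hy
    rw [mul_assoc]
    congr 1
    rw [← Complex.re_ofReal_mul, Complex.ofReal_pow, ← Complex.conj_mul']
    congr 1
    simp only [logDiff, map_sub, map_div₀, map_mul, Complex.conj_I, Complex.conj_ofReal, map_ofNat]
    field_simp
    ring
  rw [gForm, metricForm, halfNormSq_uCoord hp.1, pairing_tracelessPart]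
  simp only [tangent]
  rw [hJ]
  linear_combination derivWithin f (Set.Ici 0) (p.1.im ^ 4 * ‖p.2‖ ^ 2) * (hT - hζ)

theorem omegaForm_eq (f : ℝ → ℝ) {p : ℂ × ℂ} (hp : p ∈ dom) (a b : ℂ × ℂ) :
    omegaForm f p a b =
      -((1 - f (p.1.im ^ 4 * ‖p.2‖ ^ 2)) * (conj a.1 * b.1).im / p.1.im ^ 2 +
      derivWithin f (Set.Ici 0) (p.1.im ^ 4 * ‖p.2‖ ^ 2) * (p.1.im ^ 4 * ‖p.2‖ ^ 2) *
        (conj (logDiff p a) * logDiff p b).im) := by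
  -- The two-form is the metric with second argument `i b`, and `ζ` is complex linear.
  have h := gForm_eq f hp a (Complex.I * b.1, Complex.I * b.2)
  rw [gForm, tangent_I hp.1] at h
  rw [omegaForm, h]
  have hl : logDiff p (Complex.I * b.1, Complex.I * b.2) = Complex.I * logDiff p b := by
    simp only [logDiff]
    ring
  rw [hl]
  simp only [mul_left_comm _ Complex.I, Complex.I_mul_re]
  ring

/-! ### The parametrization -/

/-- The quartic differential `w̄ (dx₀ - z̄ dy₀)⁴`. -/
def quartic (p : ℂ × ℂ) (i j k l : Fin 2) : ℂ :=
  conj p.2 * (oneForm p.1 i * oneForm p.1 j * oneForm p.1 k * oneForm p.1 l)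

theorem tCoord_apply (p : ℂ × ℂ) (i j k l : Fin 2) : tCoord p i j k l = (quartic p i j k l).re :=
  rfl

theorem quartic_comp {p : ℂ × ℂ} (hp : 0 < p.1.im) (i j k l : Fin 2) :
    ∑ a, (jCoord p a l : ℂ) * quartic p i j k a = Complex.I * quartic p i j k l := by
  have h := oneForm_comp_jCoord hp l
  simp only [Fin.sum_univ_two, quartic] at *
  linear_combination conj p.2 * (oneForm p.1 i * oneForm p.1 j * oneForm p.1 k) * h

theorem quarticOf_param {p : ℂ × ℂ} (hp : 0 < p.1.im) (i j k l : Fin 2) :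
    quarticOf (param p) i j k l = quartic p i j k l := by
  have h := congrArg Complex.re (quartic_comp hp i j k l)
  simp only [Fin.sum_univ_two, Complex.add_re, Complex.re_ofReal_mul, Complex.I_mul_re] at h
  simp only [quarticOf, param, tCoord_apply, Fin.sum_univ_two, h]
  apply Complex.ext <;> simp

theorem param_rotAct {p : ℂ × ℂ} (hp : 0 < p.1.im) (c : Circle) :
    param (rotAct c p) = circleAct c (param p) := by
  refine Prod.ext rfl ?_
  funext i j k l
  simp only [circleAct, quarticOf_param hp]
  simp only [param, tCoord_apply, quartic, rotAct, map_mul, mul_assoc]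

/-! ### Compatibility of the parametrization with `SL(2,ℝ)` -/

/-- The automorphy factor `cz + d`. -/
def autFactor (A : SL2R) (z : ℂ) : ℂ := (A 1 0 : ℝ) * z + (A 1 1 : ℝ)

theorem sl_det (A : SL2R) : A 0 0 * A 1 1 - A 0 1 * A 1 0 = 1 := by
  rw [← Matrix.det_fin_two]
  exact A.2

theorem autFactor_ne_zero (A : SL2R) {z : ℂ} (hz : 0 < z.im) : autFactor A z ≠ 0 := by
  intro h
  have h1 := congrArg Complex.im h
  have h2 := congrArg Complex.re h
  simp [autFactor, hz.ne'] at h1 h2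
  have := sl_det A
  rw [h1] at h2 this
  simp at h2
  rw [h2] at this
  simp at this

theorem slAct_fst (A : SL2R) (p : ℂ × ℂ) :
    (slAct A p).1 = ((A 0 0 : ℝ) * p.1 + (A 0 1 : ℝ)) / autFactor A p.1 := rfl

theorem slAct_snd (A : SL2R) (p : ℂ × ℂ) : (slAct A p).2 = autFactor A p.1 ^ 4 * p.2 := rfl

theorem normSq_autFactor (A : SL2R) (z : ℂ) :
    Complex.normSq (autFactor A z) = (A 1 0 * z.re + A 1 1) ^ 2 + (A 1 0 * z.im) ^ 2 := by
  simp [autFactor, Complex.normSq_apply]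
  ring

theorem slAct_fst_im (A : SL2R) (p : ℂ × ℂ) :
    (slAct A p).1.im = p.1.im / Complex.normSq (autFactor A p.1) := by
  rw [slAct_fst, Complex.div_im, ← sub_div]
  congr 1
  simp [autFactor]
  linear_combination p.1.im * sl_det A

theorem slAct_fst_re (A : SL2R) (p : ℂ × ℂ) :
    (slAct A p).1.re = ((A 0 0 * p.1.re + A 0 1) * (A 1 0 * p.1.re + A 1 1) +
      A 0 0 * A 1 0 * p.1.im ^ 2) / Complex.normSq (autFactor A p.1) := by
  rw [slAct_fst, Complex.div_re, ← add_div]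
  congr 1
  simp [autFactor]
  ring

theorem slAct_mem_dom (A : SL2R) {p : ℂ × ℂ} (hp : p ∈ dom) : slAct A p ∈ dom := by
  have h := autFactor_ne_zero A hp.1
  refine ⟨?_, ?_⟩
  · rw [slAct_fst_im]
    exact div_pos hp.1 (Complex.normSq_pos.2 h)
  · rw [slAct_snd]
    exact mul_ne_zero (pow_ne_zero _ h) hp.2

theorem coe_inv_sl (A : SL2R) : ((A⁻¹ : SL2R) : Mat2) = !![A 1 1, -A 0 1; -A 1 0, A 0 0] := by
  rw [Matrix.SpecialLinearGroup.coe_inv, Matrix.adjugate_fin_two]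

theorem jCoord_slAct (A : SL2R) {p : ℂ × ℂ} (hp : 0 < p.1.im) :
    jCoord (slAct A p) = (A : Mat2) * jCoord p * ((A⁻¹ : SL2R) : Mat2) := by
  have hN : Complex.normSq (autFactor A p.1) ≠ 0 :=
    (Complex.normSq_pos.2 (autFactor_ne_zero A hp)).ne'
  have hy := hp.ne'
  have hd := sl_det A
  rw [jCoord, slAct_fst_im, slAct_fst_re, coe_inv_sl, jCoord]
  have hN' := (normSq_autFactor A p.1).symm
  generalize Complex.normSq (autFactor A p.1) = N at *
  generalize p.1.re = x at *
  generalize p.1.im = y at *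
  have hA : (A : Mat2) = !![A 0 0, A 0 1; A 1 0, A 1 1] := Matrix.eta_fin_two _
  rw [hA]
  generalize A 0 0 = a at *
  generalize A 0 1 = b at *
  generalize A 1 0 = c at *
  generalize A 1 1 = d at *
  -- This is `|(az + b) conj(cz + d)|² = |az + b|² |cz + d|²`; the imaginary part of the product is
  -- `y` because the determinant is `1`.
  have h01 : ((a * x + b) * (c * x + d) + a * c * y ^ 2) ^ 2 + y ^ 2 =
      ((c * x + d) ^ 2 + (c * y) ^ 2) * ((a * x + b) ^ 2 + (a * y) ^ 2) := by
    linear_combination -(y ^ 2 * (a * d - b * c + 1)) * hd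
  rw [hN'] at h01
  ext i j
  fin_cases i <;> fin_cases j <;> simp
  · field_simp
    ring
  · field_simp
    linear_combination -h01
  · field_simp
    linear_combination -hN'
  · field_simp
    ring

/-- Pull-back by `A⁻¹` rescales the form by `conj(cz + d)`; its fourth power accounts for the factor
`(cz + d)⁴` on `w`. -/
theorem oneForm_slAct (A : SL2R) {p : ℂ × ℂ} (hp : 0 < p.1.im) (i : Fin 2) :
    ∑ a, (((A⁻¹ : SL2R) : Mat2) a i : ℂ) * oneForm p.1 a =
      conj (autFactor A p.1) * oneForm (slAct A p).1 i := by
  have h : conj (autFactor A p.1) ≠ 0 := by simpa using autFactor_ne_zero A hp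
  rw [coe_inv_sl, slAct_fst]
  fin_cases i
  · simp [oneForm, autFactor, Fin.sum_univ_two]
    ring
  · simp only [oneForm, Fin.sum_univ_two]
    simp
    field_simp
    ring

theorem quartic_slAct (A : SL2R) {p : ℂ × ℂ} (hp : 0 < p.1.im) (i j k l : Fin 2) :
    quartic (slAct A p) i j k l = ∑ a, ∑ b, ∑ c, ∑ d, (((A⁻¹ : SL2R) : Mat2) a i : ℂ) *
      (((A⁻¹ : SL2R) : Mat2) b j : ℂ) * (((A⁻¹ : SL2R) : Mat2) c k : ℂ) *
      (((A⁻¹ : SL2R) : Mat2) d l : ℂ) * quartic p a b c d := by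
  have hi := oneForm_slAct A hp i
  have hj := oneForm_slAct A hp j
  have hk := oneForm_slAct A hp k
  have hl := oneForm_slAct A hp l
  have : quartic (slAct A p) i j k l = conj p.2 *
      ((conj (autFactor A p.1) * oneForm (slAct A p).1 i) *
      (conj (autFactor A p.1) * oneForm (slAct A p).1 j) *
      (conj (autFactor A p.1) * oneForm (slAct A p).1 k) *
      (conj (autFactor A p.1) * oneForm (slAct A p).1 l)) := by
    rw [quartic, slAct_snd, map_mul, map_pow]
    ring
  rw [this, ← hi, ← hj, ← hk, ← hl]
  simp only [Fin.sum_univ_two, quartic]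
  ring

theorem param_slAct (A : SL2R) {p : ℂ × ℂ} (hp : 0 < p.1.im) :
    param (slAct A p) = pullBackAct A (param p) := by
  refine Prod.ext (jCoord_slAct A hp) ?_
  funext i j k l
  simp only [param, pullBackAct, tCoord_apply, quartic_slAct A hp, Complex.re_sum,
    ← Complex.ofReal_mul, Complex.re_ofReal_mul]

theorem param_mem_modMF {p : ℂ × ℂ} (hp : p ∈ dom) : param p ∈ modMF := by
  have hy : p.1.im ≠ 0 := hp.1.ne'
  refine ⟨⟨⟨?_, ![1, 0], by simp, ?_⟩, ?_, ?_⟩, ?_⟩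
  · ext i j
    fin_cases i <;> fin_cases j <;> simp [param, jCoord] <;> field_simp <;> ring
  · simpa [param, jCoord, area, Matrix.mulVec, dotProduct] using hp.1
  · intro i j k l
    simp only [param, tCoord]
    exact ⟨by ring_nf, by ring_nf, by ring_nf⟩
  · intro i j k l
    have hi := oneForm_comp_jCoord hp.1 i
    have hj := oneForm_comp_jCoord hp.1 j
    simp only [param, tCoord_apply, ← Complex.re_ofReal_mul, ← Complex.re_sum, ← Complex.neg_re]
    congr 1
    have : -quartic p i j k l = conj p.2 * ((Complex.I * oneForm p.1 i) *
        (Complex.I * oneForm p.1 j) * oneForm p.1 k * oneForm p.1 l) := by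
      rw [quartic]
      linear_combination -(conj p.2 * (oneForm p.1 i * oneForm p.1 j * oneForm p.1 k *
        oneForm p.1 l)) * Complex.I_mul_I
    rw [this, ← hi, ← hj]
    simp only [Fin.sum_univ_two, quartic]
    push_cast
    ring
  · intro h
    apply hp.2
    have h0 := congrFun (congrFun (congrFun (congrFun h 0) 0) 0) 0
    have h1 := congrFun (congrFun (congrFun (congrFun h 0) 0) 0) 1
    simp [param, tCoord, oneForm] at h0 h1
    rw [h0] at h1
    apply Complex.ext <;> simp_all

theorem param_injOn : Set.InjOn param dom := by
  intro p hp q hq h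
  have hy : p.1.im ≠ 0 := hp.1.ne'
  have hy' : q.1.im ≠ 0 := hq.1.ne'
  have hJ := congrArg Prod.fst h
  have hT := congrArg Prod.snd h
  have h10 := congrFun (congrFun hJ 1) 0
  have h00 := congrFun (congrFun hJ 0) 0
  have t0 := congrFun (congrFun (congrFun (congrFun hT 0) 0) 0) 0
  have t1 := congrFun (congrFun (congrFun (congrFun hT 0) 0) 0) 1
  simp [param, jCoord] at h10 h00
  rw [h10, div_left_inj' hy'] at h00
  have hz : p.1 = q.1 := Complex.ext h00 h10
  simp [param, tCoord, oneForm, hz] at t0 t1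
  refine Prod.ext hz (Complex.ext t0 ?_)
  rw [t0] at t1
  simpa [hy'] using t1

/-- The values of a tensor on `4 - n` copies of `e₀` followed by `n` copies of `e₁`. -/
def Tensor04.components (T : Tensor04) : ℕ → ℝ
  | 0 => T 0 0 0 0
  | 1 => T 0 0 0 1
  | 2 => T 0 0 1 1
  | 3 => T 0 1 1 1
  | _ => T 1 1 1 1

theorem IsTotallySymmetric.eq_symTensor {T : Tensor04} (h : IsTotallySymmetric T) :
    T = symTensor T.components := by
  have h1 : ∀ k l, T 1 0 k l = T 0 1 k l := fun k l => (h 1 0 k l).1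
  have h2 : ∀ i l, T i 1 0 l = T i 0 1 l := fun i l => (h i 1 0 l).2.1
  have h3 : ∀ i j, T i j 1 0 = T i j 0 1 := fun i j => (h i j 1 0).2.2
  funext i j k l
  fin_cases i <;> fin_cases j <;> fin_cases k <;> fin_cases l <;>
    simp [symTensor, Tensor04.components, h1, h2, h3]

theorem exists_param_eq {P : Mat2 × Tensor04} (hP : P ∈ modMF) : ∃ p ∈ dom, param p = P := by
  obtain ⟨J, T⟩ := P
  obtain ⟨⟨⟨hJ, v, hv, hpos⟩, hsym, htype⟩, hne⟩ := hP
  have e00 := congrFun (congrFun hJ 0) 0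
  have e01 := congrFun (congrFun hJ 0) 1
  have e10 := congrFun (congrFun hJ 1) 0
  have e11 := congrFun (congrFun hJ 1) 1
  simp [Matrix.mul_apply, Fin.sum_univ_two] at e00 e01 e10 e11
  simp [area, Matrix.mulVec, dotProduct, Fin.sum_univ_two] at hpos
  simp only at hsym htype hne
  -- The off-diagonal entry of `J² = -1` is `(tr J) J₀₁ = 0`; a non-zero trace would force `J₀₀² =
  -- -1`.
  have htr : J 1 1 = -J 0 0 := by
    by_contra h
    have h' : J 0 0 + J 1 1 ≠ 0 := fun h'' => h (by linarith)
    have hb : J 0 1 = 0 := by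
      apply mul_left_cancel₀ h'
      linarith
    rw [hb] at e00
    nlinarith
  rw [htr] at e01 e10 e11 hpos
  have hc : 0 < J 1 0 := by
    have hc0 : J 1 0 ≠ 0 := by
      intro h
      rw [h] at e00
      nlinarith
    by_contra hneg
    have hlt : J 1 0 < 0 := lt_of_le_of_ne (not_lt.1 hneg) hc0
    -- Completing the square shows that `J₁₀` times `area(v, Jv)` is non-negative, which excludes
    -- `J₁₀ < 0`.
    have : J 1 0 * (v 0 * (J 1 0 * v 0 + -J 0 0 * v 1) - v 1 * (J 0 0 * v 0 + J 0 1 * v 1)) =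
      (J 1 0 * v 0 - J 0 0 * v 1) ^ 2 + v 1 ^ 2 := by
      linear_combination -(v 1 ^ 2) * e00
    nlinarith [sq_nonneg (J 1 0 * v 0 - J 0 0 * v 1), sq_nonneg (v 1)]
  set x := J 0 0 / J 1 0 with hx
  set y := 1 / J 1 0 with hy
  have hypos : 0 < y := by positivity
  have hc' := hc.ne'
  set u := T 0 0 0 0 with hu
  -- Solves `T₀₀₀₀ = Re w` and `T₀₀₀₁ = y Im w - x Re w`.
  set w : ℂ := ⟨u, (T 0 0 0 1 + u * x) / y⟩ with hw
  have hjc : jCoord (⟨x, y⟩, w) = J := by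
    ext i j
    fin_cases i <;> fin_cases j <;> simp [jCoord, hx, hy]
    · field_simp
    · field_simp
      linarith
    · rw [htr]
      field_simp
  have hJ00 : J 0 0 = x / y := by
    rw [hx, hy]
    field_simp
  have hJ10 : J 1 0 = 1 / y := by
    rw [hy]
    field_simp
  have hTs := hsym.eq_symTensor
  set s : ℕ → ℝ := T.components with hs
  -- Since `J e₀ = (x e₀ + e₁)/y`, the type condition on `(e₀, e₀)` is a two-term recurrence for the
  -- components.
  have hrec : ∀ k l : Fin 2, s (k + l + 2) =
      -(x ^ 2 + y ^ 2) * s (k + l) - 2 * x * s (k + l + 1) := by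
    intro k l
    have h := htype 0 0 k l
    simp only [Fin.sum_univ_two, hJ00, hJ10, hTs, symTensor, Fin.val_zero, Fin.val_one] at h
    field_simp at h
    ring_nf at h ⊢
    linarith
  have r2 := hrec 0 0
  have r3 := hrec 0 1
  have r4 := hrec 1 1
  simp only [Fin.val_zero, Fin.val_one, zero_add, add_zero, Nat.reduceAdd] at r2 r3 r4
  have hT : tCoord (⟨x, y⟩, w) = T := by
    rw [tCoord_eq_symTensor, hTs]
    have c0 : tComp (⟨x, y⟩, w) 0 = s 0 := by
      simp [tComp, hw, hs, Tensor04.components, hu]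
    have c1 : tComp (⟨x, y⟩, w) 1 = s 1 := by
      simp [tComp, hw, hs, Tensor04.components, hu]
      field_simp
      ring
    -- The number `-z̄` is a root of the characteristic polynomial, so the components of `tCoord`
    -- obey the same recurrence and agree once the first two do.
    have hcomp : ∀ n, tComp (⟨x, y⟩, w) (n + 2) =
        -(x ^ 2 + y ^ 2) * tComp (⟨x, y⟩, w) n - 2 * x * tComp (⟨x, y⟩, w) (n + 1) := by
      intro n
      have hz : (-conj (⟨x, y⟩ : ℂ)) ^ 2 = ((-(x ^ 2 + y ^ 2) : ℝ) : ℂ) -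
          ((2 * x : ℝ) : ℂ) * (-conj (⟨x, y⟩ : ℂ)) := by
        apply Complex.ext <;> simp [sq] <;> ring
      simp only [tComp]
      rw [← Complex.re_ofReal_mul, ← Complex.re_ofReal_mul, ← Complex.sub_re]
      congr 1
      rw [pow_add, hz]
      ring
    have c2 := hcomp 0
    have c3 := hcomp 1
    have c4 := hcomp 2
    simp only [zero_add, Nat.reduceAdd] at c2 c3 c4
    rw [c0, c1, ← r2] at c2
    rw [c1, c2, ← r3] at c3
    rw [c2, c3, ← r4] at c4
    funext i j k l
    fin_cases i <;> fin_cases j <;> fin_cases k <;> fin_cases l <;>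
      simp [symTensor, c0, c1, c2, c3, c4]
  refine ⟨(⟨x, y⟩, w), ⟨hypos, fun h0 => hne ?_⟩, Prod.ext hjc hT⟩
  rw [← hT, show w = 0 from h0]
  funext i j k l
  simp [tCoord]

theorem isParametrization : IsParametrization where
  bijOn := ⟨fun _ hp => param_mem_modMF hp, param_injOn, fun _ hP => exists_param_eq hP⟩
  immersion p hp a hJ hT := by
    have hy : p.1.im ≠ 0 := hp.1.ne'
    rw [jDot_eq hp.1] at hJ
    have h10 := congrFun (congrFun hJ 1) 0
    have h00 := congrFun (congrFun hJ 0) 0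
    simp [hy] at h10 h00
    rw [h10] at h00
    simp [hy] at h00
    have hz : a.1 = 0 := Complex.ext h00 h10
    have t0 := congrFun (congrFun (congrFun (congrFun hT 0) 0) 0) 0
    have t1 := congrFun (congrFun (congrFun (congrFun hT 0) 0) 0) 1
    rw [tDot_eq] at t0 t1
    simp [quarticDot, oneForm, oneFormDot, hz] at t0 t1
    rw [t0] at t1
    refine Prod.ext hz (Complex.ext t0 ?_)
    simpa [hy] using t1
  rotAct_eq c p hp := param_rotAct hp.1 c
  pslAct_eq A p hp := param_slAct A hp.1

/-! ### The norm of the quartic differential and the two Hamiltonians -/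

/-- `‖U‖² / 2 = y⁴ |w|²`. -/
def fibreNorm (p : ℂ × ℂ) : ℝ := p.1.im ^ 4 * ‖p.2‖ ^ 2

theorem fibreNorm_pos {p : ℂ × ℂ} (hp : p ∈ dom) : 0 < fibreNorm p :=
  mul_pos (pow_pos hp.1 4) (pow_pos (norm_pos_iff.2 hp.2) 2)

theorem halfNormSq_eq {p : ℂ × ℂ} (hp : p ∈ dom) :
    halfNormSq (jCoord p) (uCoord p) = fibreNorm p :=
  halfNormSq_uCoord hp.1

theorem H₁_eq (f : ℝ → ℝ) {p : ℂ × ℂ} (hp : p ∈ dom) : H₁ f p = f (fibreNorm p) / 2 := by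
  rw [H₁, halfNormSq_eq hp]

/-- The function `x / y`. -/
def ratio (p : ℂ × ℂ) : ℝ := p.1.re / p.1.im

theorem H₂_eq (f : ℝ → ℝ) (p : ℂ × ℂ) : H₂ f p = 2 * ratio p * (1 - f (fibreNorm p)) := rfl

/-- The differential of `x / y`. -/
def ratioDiff (p v : ℂ × ℂ) : ℝ := v.1.re / p.1.im - p.1.re * v.1.im / p.1.im ^ 2

theorem omegaForm_eq_fibreNorm (f : ℝ → ℝ) {p : ℂ × ℂ} (hp : p ∈ dom) (a b : ℂ × ℂ) :
    omegaForm f p a b =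
      -((1 - f (fibreNorm p)) * (conj a.1 * b.1).im / p.1.im ^ 2 +
      derivWithin f (Set.Ici 0) (fibreNorm p) * fibreNorm p *
        (conj (logDiff p a) * logDiff p b).im) :=
  omegaForm_eq f hp a b

theorem gForm_eq_fibreNorm (f : ℝ → ℝ) {p : ℂ × ℂ} (hp : p ∈ dom) (a b : ℂ × ℂ) :
    gForm f p a b =
      (1 - f (fibreNorm p)) * (conj a.1 * b.1).re / p.1.im ^ 2 +
      derivWithin f (Set.Ici 0) (fibreNorm p) * fibreNorm p *
        (conj (logDiff p a) * logDiff p b).re :=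
  gForm_eq f hp a b

theorem re_logDiff (p v : ℂ × ℂ) :
    (logDiff p v).re = (v.2 / p.2).re + 2 * v.1.im / p.1.im := by
  simp [logDiff, mul_assoc, mul_div_assoc]

theorem im_logDiff (p v : ℂ × ℂ) :
    (logDiff p v).im = (v.2 / p.2).im - 2 * v.1.re / p.1.im := by
  simp [logDiff, mul_assoc, mul_div_assoc]

theorem contDiff_re : ContDiff ℝ ∞ (fun p : ℂ × ℂ => p.1.re) :=
  (Complex.reCLM.comp (ContinuousLinearMap.fst ℝ ℂ ℂ)).contDiff

theorem contDiff_im : ContDiff ℝ ∞ (fun p : ℂ × ℂ => p.1.im) :=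
  (Complex.imCLM.comp (ContinuousLinearMap.fst ℝ ℂ ℂ)).contDiff

theorem contDiffOn_div_im {g : ℂ × ℂ → ℝ} (hg : ContDiffOn ℝ ∞ g dom) (n : ℕ) :
    ContDiffOn ℝ ∞ (fun p => g p / p.1.im ^ n) dom :=
  hg.div (contDiff_im.contDiffOn.pow n) fun _ hp => pow_ne_zero _ (ne_of_gt hp.1)

theorem contDiffOn_ratio : ContDiffOn ℝ ∞ ratio dom :=
  contDiff_re.contDiffOn.div contDiff_im.contDiffOn fun _ hp => ne_of_gt hp.1

theorem hasFDerivAt_ratio {p : ℂ × ℂ} (hp : p ∈ dom) :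
    ∃ L : ℂ × ℂ →L[ℝ] ℝ, HasFDerivAt ratio L p ∧ ∀ v, L v = ratioDiff p v := by
  refine ⟨_, HasFDerivAt.real_div (hasFDerivAt_re p) (hasFDerivAt_im p) (ne_of_gt hp.1),
    fun v => ?_⟩
  simp [ratioDiff]
  ring

theorem contDiff_fibreNorm : ContDiff ℝ ∞ fibreNorm :=
  (contDiff_im.pow 4).mul (contDiff_snd.norm_sq ℝ)

/-- `Re ζ` is the differential of `log (y²|w|)`, and `fibreNorm` is the square of `y²|w|`. -/
theorem hasFDerivAt_fibreNorm {p : ℂ × ℂ} (hp : p ∈ dom) :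
    ∃ L : ℂ × ℂ →L[ℝ] ℝ, HasFDerivAt fibreNorm L p ∧
      ∀ v, L v = 2 * fibreNorm p * (logDiff p v).re := by
  have h := ((hasFDerivAt_im p).pow 4).mul
    ((ContinuousLinearMap.snd ℝ ℂ ℂ).hasFDerivAt (x := p)).norm_sq
  refine ⟨_, h, fun v => ?_⟩
  have hy : p.1.im ≠ 0 := ne_of_gt hp.1
  have hw : Complex.normSq p.2 ≠ 0 := (Complex.normSq_pos.2 hp.2).ne'
  rw [re_logDiff, fibreNorm, ← Complex.normSq_eq_norm_sq, Complex.div_re]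
  simp [Complex.inner]
  rw [← Complex.normSq_eq_norm_sq]
  field_simp
  ring

/-! ### Differentials and signs of the profile and of the Hamiltonians -/

section Profile

variable {f : ℝ → ℝ} (hf : ContDiffOn ℝ ∞ f (Set.Ici 0))

include hf

theorem contDiffAt_profile {t : ℝ} (ht : 0 < t) : ContDiffAt ℝ ∞ f t :=
  hf.contDiffAt (Ici_mem_nhds ht)

/-- The one-sided derivative is an ordinary one away from `0`, a value that `fibreNorm` never takes
on `dom`. -/
theorem hasDerivAt_profile {t : ℝ} (ht : 0 < t) :
    HasDerivAt f (derivWithin f (Set.Ici 0) t) t := by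
  rw [derivWithin_of_mem_nhds (Ici_mem_nhds ht)]
  exact ((contDiffAt_profile hf ht).differentiableAt (by simp)).hasDerivAt

theorem contDiffOn_profile_fibreNorm : ContDiffOn ℝ ∞ (fun p => f (fibreNorm p)) dom :=
  hf.comp contDiff_fibreNorm.contDiffOn fun _ hp => (fibreNorm_pos hp).le

theorem contDiffOn_derivWithin_fibreNorm :
    ContDiffOn ℝ ∞ (fun p => derivWithin f (Set.Ici 0) (fibreNorm p)) dom :=
  (hf.derivWithin (uniqueDiffOn_Ici 0) (by simp)).comp contDiff_fibreNorm.contDiffOn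
    fun _ hp => (fibreNorm_pos hp).le

theorem contDiffOn_H₁ : ContDiffOn ℝ ∞ (H₁ f) dom :=
  ((contDiffOn_profile_fibreNorm hf).div_const 2).congr fun _ hp => H₁_eq f hp

theorem contDiffOn_H₂ : ContDiffOn ℝ ∞ (H₂ f) dom :=
  (contDiffOn_const.mul contDiffOn_ratio).mul
    (contDiffOn_const.sub (contDiffOn_profile_fibreNorm hf))

theorem hasFDerivAt_profile_fibreNorm {p : ℂ × ℂ} (hp : p ∈ dom) :
    ∃ L : ℂ × ℂ →L[ℝ] ℝ, HasFDerivAt (fun q => f (fibreNorm q)) L p ∧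
      ∀ v, L v = derivWithin f (Set.Ici 0) (fibreNorm p) *
        (2 * fibreNorm p * (logDiff p v).re) := by
  obtain ⟨L, hL, hL'⟩ := hasFDerivAt_fibreNorm hp
  refine ⟨_, (hasDerivAt_profile hf (fibreNorm_pos hp)).comp_hasFDerivAt p hL, fun v => ?_⟩
  simp [hL']

theorem fderiv_H₁ {p : ℂ × ℂ} (hp : p ∈ dom) (v : ℂ × ℂ) :
    fderiv ℝ (H₁ f) p v =
      derivWithin f (Set.Ici 0) (fibreNorm p) * fibreNorm p * (logDiff p v).re := by
  obtain ⟨L, hL, hL'⟩ := hasFDerivAt_profile_fibreNorm hf hp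
  have h : H₁ f =ᶠ[nhds p] fun q => 1 / 2 * f (fibreNorm q) := by
    filter_upwards [isOpen_dom.mem_nhds hp] with q hq
    rw [H₁_eq f hq]
    ring
  rw [h.fderiv_eq, (hL.const_mul (1 / 2)).fderiv]
  simp [hL']
  ring

theorem fderiv_H₂ {p : ℂ × ℂ} (hp : p ∈ dom) (v : ℂ × ℂ) :
    fderiv ℝ (H₂ f) p v = 2 * (1 - f (fibreNorm p)) * ratioDiff p v -
      4 * ratio p * (derivWithin f (Set.Ici 0) (fibreNorm p) * fibreNorm p *
        (logDiff p v).re) := by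
  obtain ⟨L, hL, hL'⟩ := hasFDerivAt_profile_fibreNorm hf hp
  obtain ⟨M, hM, hM'⟩ := hasFDerivAt_ratio hp
  have h : HasFDerivAt (H₂ f) _ p := (hM.const_mul 2).mul (hL.const_sub 1)
  rw [h.fderiv]
  simp only [_root_.add_apply, _root_.smul_apply, _root_.neg_apply, hL', hM', smul_eq_mul,
    fibreNorm]
  ring

end Profile

section Sign

variable {f : ℝ → ℝ} (hf : ContDiffOn ℝ ∞ f (Set.Ici 0)) (hf0 : f 0 = 0)
  (hf' : ∀ t : ℝ, 0 ≤ t → derivWithin f (Set.Ici 0) t < 0)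

include hf hf'

theorem strictAntiOn_profile : StrictAntiOn f (Set.Ici 0) := by
  refine strictAntiOn_of_deriv_neg (convex_Ici 0) hf.continuousOn fun t ht => ?_
  rw [interior_Ici] at ht
  rw [(hasDerivAt_profile hf ht).deriv]
  exact hf' t (le_of_lt ht)

include hf0

theorem one_sub_profile_pos {t : ℝ} (ht : 0 < t) : 0 < 1 - f t := by
  have := strictAntiOn_profile hf hf' (Set.mem_Ici.2 le_rfl) (Set.mem_Ici.2 ht.le) ht
  rw [hf0] at this
  linarith

end Sign

/-! ### The generators of the circle action and of the dilations -/

/-- The generator of the circle action. -/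
def rotField (p : ℂ × ℂ) : ℂ × ℂ := (0, Complex.I * p.2)

/-- The generator of the dilations `(e^{2t} z, e^{-4t} w)`. -/
def dilField (p : ℂ × ℂ) : ℂ × ℂ := (2 * p.1, -4 * p.2)

theorem logDiff_rotField {p : ℂ × ℂ} (hp : p ∈ dom) : logDiff p (rotField p) = Complex.I := by
  simp [logDiff, rotField, mul_div_assoc, div_self hp.2]

theorem logDiff_dilField {p : ℂ × ℂ} (hp : p ∈ dom) :
    logDiff p (dilField p) = -(4 * ratio p : ℝ) * Complex.I := by
  have hy : p.1.im ≠ 0 := ne_of_gt hp.1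
  have hw : -4 * p.2 / p.2 = -4 := mul_div_cancel_right₀ _ hp.2
  apply Complex.ext
  · rw [re_logDiff, dilField, hw]
    simp [mul_div_assoc, hy]
    norm_num
  · rw [im_logDiff, dilField, hw]
    simp [ratio]
    ring

theorem omegaForm_rotField {f : ℝ → ℝ} (hf : ContDiffOn ℝ ∞ f (Set.Ici 0)) {p : ℂ × ℂ}
    (hp : p ∈ dom) (v : ℂ × ℂ) : omegaForm f p (rotField p) v = fderiv ℝ (H₁ f) p v := by
  rw [omegaForm_eq_fibreNorm f hp, fderiv_H₁ hf hp, logDiff_rotField hp]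
  simp [rotField]

theorem omegaForm_dilField {f : ℝ → ℝ} (hf : ContDiffOn ℝ ∞ f (Set.Ici 0)) {p : ℂ × ℂ}
    (hp : p ∈ dom) (v : ℂ × ℂ) : omegaForm f p (dilField p) v = fderiv ℝ (H₂ f) p v := by
  have hy : p.1.im ≠ 0 := ne_of_gt hp.1
  rw [omegaForm_eq_fibreNorm f hp, fderiv_H₂ hf hp, logDiff_dilField hp]
  simp [dilField, ratioDiff]
  field_simp
  ring

theorem contDiff_rotField : ContDiff ℝ ∞ rotField :=
  contDiff_const.prodMk (contDiff_const.mul contDiff_snd)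

theorem contDiff_dilField : ContDiff ℝ ∞ dilField :=
  (contDiff_const.mul contDiff_fst).prodMk (contDiff_const.mul contDiff_snd)

/-! ### The two actions -/

/-- A map that preserves the norm and the logarithmic differential of the quartic differential,
and the hyperbolic metric and area form, preserves the two-form `Ω_f`. -/
theorem omegaForm_congr (f : ℝ → ℝ) {p q : ℂ × ℂ} (hp : p ∈ dom) (hq : q ∈ dom)
    {a b a' b' : ℂ × ℂ} (hs : fibreNorm q = fibreNorm p) (ha : logDiff q a' = logDiff p a)
    (hb : logDiff q b' = logDiff p b)
    (hab : (conj a'.1 * b'.1).im / q.1.im ^ 2 = (conj a.1 * b.1).im / p.1.im ^ 2) :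
    omegaForm f q a' b' = omegaForm f p a b := by
  rw [omegaForm_eq_fibreNorm f hp, omegaForm_eq_fibreNorm f hq, hs, ha, hb, mul_div_assoc, hab,
    mul_div_assoc]

theorem rotAct_mem_dom (c : Circle) {p : ℂ × ℂ} (hp : p ∈ dom) : rotAct c p ∈ dom :=
  ⟨hp.1, mul_ne_zero (Circle.coe_ne_zero c) hp.2⟩

theorem fibreNorm_rotAct (c : Circle) (p : ℂ × ℂ) : fibreNorm (rotAct c p) = fibreNorm p := by
  simp only [fibreNorm, rotAct, norm_mul, Circle.norm_coe, one_mul]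

theorem logDiff_rotAct (c : Circle) (p a : ℂ × ℂ) :
    logDiff (rotAct c p) (rotAct c a) = logDiff p a := by
  simp only [logDiff, rotAct]
  rw [mul_div_mul_left _ _ (Circle.coe_ne_zero c)]

theorem hasFDerivAt_rotAct (c : Circle) (p : ℂ × ℂ) :
    HasFDerivAt (rotAct c) ((ContinuousLinearMap.fst ℝ ℂ ℂ).prod
      ((c : ℂ) • ContinuousLinearMap.snd ℝ ℂ ℂ)) p :=
  ((ContinuousLinearMap.fst ℝ ℂ ℂ).prod ((c : ℂ) • ContinuousLinearMap.snd ℝ ℂ ℂ)).hasFDerivAt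

theorem fderiv_rotAct (c : Circle) (p a : ℂ × ℂ) : fderiv ℝ (rotAct c) p a = rotAct c a := by
  rw [(hasFDerivAt_rotAct c p).fderiv]
  simp [rotAct]

theorem preservesOn_omegaForm_rotAct (f : ℝ → ℝ) (c : Circle) :
    PreservesOn dom (omegaForm f) (rotAct c) := by
  intro p hp a b
  rw [fderiv_rotAct, fderiv_rotAct]
  exact omegaForm_congr f hp (rotAct_mem_dom c hp) (fibreNorm_rotAct c p) (logDiff_rotAct c p a)
    (logDiff_rotAct c p b) rfl

theorem preservesOn_gForm_rotAct (f : ℝ → ℝ) (c : Circle) :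
    PreservesOn dom (gForm f) (rotAct c) := by
  intro p hp a b
  rw [fderiv_rotAct, fderiv_rotAct, gForm_eq_fibreNorm f hp,
    gForm_eq_fibreNorm f (rotAct_mem_dom c hp), fibreNorm_rotAct, logDiff_rotAct, logDiff_rotAct]
  rfl

theorem H₁_rotAct (f : ℝ → ℝ) (c : Circle) {p : ℂ × ℂ} (hp : p ∈ dom) :
    H₁ f (rotAct c p) = H₁ f p := by
  rw [H₁_eq f hp, H₁_eq f (rotAct_mem_dom c hp), fibreNorm_rotAct]

theorem hasDerivAt_exp_rotAct (X : ℝ) (p : ℂ × ℂ) (t : ℝ) :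
    HasDerivAt (fun t : ℝ => rotAct (Circle.exp (t * X)) p)
      (X • rotField (rotAct (Circle.exp (t * X)) p)) t := by
  have h : HasDerivAt (fun t : ℝ => Complex.exp ((t * X : ℝ) * Complex.I)) _ t :=
    ((((hasDerivAt_id t).mul_const X).ofReal_comp).mul_const Complex.I).cexp
  have h2 := (hasDerivAt_const t p.1).prodMk (h.mul_const p.2)
  convert h2 using 1
  · funext s
    simp [rotAct, Circle.coe_exp]
  · ext1
    · simp [rotField]
    · simp [rotField, rotAct, Circle.coe_exp]
      ring

theorem isHamiltonianAction_rotAct {f : ℝ → ℝ} (hf : ContDiffOn ℝ ∞ f (Set.Ici 0)) :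
    IsHamiltonianAction (fun t : ℝ => Circle.exp t) (fun _ t => t) dom (omegaForm f)
      rotAct (circleMoment f) where
  mapsTo c _ hp := rotAct_mem_dom c hp
  one_act p _ := by simp [rotAct]
  mul_act g h p _ := by simp [rotAct, mul_assoc]
  smooth_act c := (contDiff_fst.prodMk (contDiff_const.mul contDiff_snd)).contDiffOn
  symplectic := preservesOn_omegaForm_rotAct f
  smooth_moment X := by
    simpa [circleMoment] using (contDiffOn_H₁ hf).mul contDiffOn_const
  equivariant g p hp X := by simp [circleMoment, H₁_rotAct f g hp]
  generator X p hp := by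
    refine ⟨X • rotField p, ?_, fun v => ?_⟩
    · have h := hasDerivAt_exp_rotAct X p 0
      simpa [rotAct] using h
    · have hd : DifferentiableAt ℝ (H₁ f) p :=
        ((contDiffOn_H₁ hf).contDiffAt (isOpen_dom.mem_nhds hp)).differentiableAt (by simp)
      have h := omegaForm_rotField hf hp v
      rw [omegaForm_eq_fibreNorm f hp] at h ⊢
      have h2 : (fun q => circleMoment f q X) = fun q => H₁ f q * X := by
        funext q
        simp [circleMoment]
      have h3 : logDiff p (X • rotField p) = X * logDiff p (rotField p) := by
        simp only [logDiff, Prod.smul_fst, Prod.smul_snd, Complex.real_smul]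
        ring
      rw [h2, (hd.hasFDerivAt.mul_const X).fderiv, h3]
      simp only [_root_.smul_apply, smul_eq_mul, ← h, map_mul, Complex.conj_ofReal, mul_assoc,
        Complex.im_ofReal_mul]
      simp [rotField]
      ring

/-! ### Invariance under `SL(2,ℝ)` -/

theorem one_slAct (p : ℂ × ℂ) : slAct 1 p = p := by
  simp [slAct]

theorem autFactor_mul (A B : SL2R) {p : ℂ × ℂ} (hp : 0 < p.1.im) :
    autFactor (A * B) p.1 = autFactor A (slAct B p).1 * autFactor B p.1 := by
  have h := autFactor_ne_zero B hp
  rw [slAct_fst, autFactor, autFactor]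
  simp only [Matrix.SpecialLinearGroup.coe_mul, Matrix.mul_apply, Fin.sum_univ_two]
  push_cast
  field_simp
  rw [autFactor]
  ring

theorem slAct_mul (A B : SL2R) {p : ℂ × ℂ} (hp : p ∈ dom) :
    slAct (A * B) p = slAct A (slAct B p) := by
  have h := autFactor_ne_zero B hp.1
  have h' := autFactor_ne_zero A (slAct_mem_dom B hp).1
  have hm := autFactor_mul A B hp.1
  refine Prod.ext ?_ ?_
  · rw [slAct_fst, slAct_fst, hm, slAct_fst B p]
    rw [slAct_fst B p] at h'
    simp only [Matrix.SpecialLinearGroup.coe_mul, Matrix.mul_apply, Fin.sum_univ_two]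
    push_cast
    field_simp
    rw [autFactor]
    ring
  · rw [slAct_snd, slAct_snd, slAct_snd, hm]
    ring

theorem fibreNorm_slAct (A : SL2R) {p : ℂ × ℂ} (hp : p ∈ dom) :
    fibreNorm (slAct A p) = fibreNorm p := by
  have h : ‖autFactor A p.1‖ ≠ 0 := norm_ne_zero_iff.2 (autFactor_ne_zero A hp.1)
  rw [fibreNorm, fibreNorm, slAct_fst_im, slAct_snd, Complex.normSq_eq_norm_sq, norm_mul, norm_pow]
  field_simp

/-- The differential of the action of `SL(2,ℝ)`. -/
def slDiff (A : SL2R) (p a : ℂ × ℂ) : ℂ × ℂ :=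
  (a.1 / autFactor A p.1 ^ 2, 4 * autFactor A p.1 ^ 3 * ((A 1 0 : ℝ) * a.1) * p.2 +
    autFactor A p.1 ^ 4 * a.2)

theorem fderiv_slAct (A : SL2R) {p : ℂ × ℂ} (hp : p ∈ dom) (a : ℂ × ℂ) :
    fderiv ℝ (slAct A) p a = slDiff A p a := by
  have hD := autFactor_ne_zero A hp.1
  have hd : ((A 0 0 : ℝ) : ℂ) * (A 1 1 : ℝ) - (A 0 1 : ℝ) * (A 1 0 : ℝ) = 1 := by
    exact_mod_cast sl_det A
  have h1 : HasDerivAt (fun z : ℂ => autFactor A z) ((A 1 0 : ℝ) : ℂ) p.1 := by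
    simpa [autFactor] using
      ((hasDerivAt_id p.1).const_mul ((A 1 0 : ℝ) : ℂ)).add_const ((A 1 1 : ℝ) : ℂ)
  have h2 : HasDerivAt (fun z : ℂ => ((A 0 0 : ℝ) * z + (A 0 1 : ℝ) : ℂ)) ((A 0 0 : ℝ) : ℂ)
      p.1 := by
    simpa using ((hasDerivAt_id p.1).const_mul ((A 0 0 : ℝ) : ℂ)).add_const ((A 0 1 : ℝ) : ℂ)
  -- The action is holomorphic: it is differentiated over `ℂ` and the scalars are then restricted.
  have hfst : HasFDerivAt (𝕜 := ℂ) (fun q : ℂ × ℂ => q.1) _ p :=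
    (ContinuousLinearMap.fst ℂ ℂ ℂ).hasFDerivAt
  have hsnd : HasFDerivAt (𝕜 := ℂ) (fun q : ℂ × ℂ => q.2) _ p :=
    (ContinuousLinearMap.snd ℂ ℂ ℂ).hasFDerivAt
  have h3 : HasFDerivAt (𝕜 := ℂ) (slAct A) _ p :=
    ((h2.div h1 hD).comp_hasFDerivAt p hfst).prodMk
      (((h1.pow 4).comp_hasFDerivAt p hfst).mul hsnd)
  rw [(h3.restrictScalars ℝ).fderiv]
  refine Prod.ext ?_ ?_
  · simp [slDiff]
    field_simp
    rw [autFactor]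
    linear_combination a.1 * hd
  · simp [slDiff]
    ring

/-- Conceptually, `Re ζ = ½ d log s` is invariant, and a complex-linear form is determined by its
real part. -/
theorem logDiff_slAct (A : SL2R) {p : ℂ × ℂ} (hp : p ∈ dom) (a : ℂ × ℂ) :
    logDiff (slAct A p) (slDiff A p a) = logDiff p a := by
  have hD := autFactor_ne_zero A hp.1
  have hD' : conj (autFactor A p.1) ≠ 0 := by simpa using hD
  have hw := hp.2
  have hy : (p.1.im : ℂ) ≠ 0 := by exact_mod_cast ne_of_gt hp.1
  -- This identity cancels the derivative of `(cz + d)⁴` against the change of `1/y`.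
  have h : autFactor A p.1 - conj (autFactor A p.1) = 2 * Complex.I * (A 1 0 : ℝ) * p.1.im := by
    simp [autFactor, Complex.ext_iff]
    ring
  rw [logDiff, logDiff, slAct_fst_im, slAct_snd, slDiff, Complex.ofReal_div,
    Complex.normSq_eq_conj_mul_self]
  generalize conj (autFactor A p.1) = E at *
  generalize autFactor A p.1 = D at *
  have e : (4 * D ^ 3 * ((A 1 0 : ℝ) * a.1) * p.2 + D ^ 4 * a.2) / (D ^ 4 * p.2) -
      2 * Complex.I * (a.1 / D ^ 2) / (p.1.im / (E * D)) - (a.2 / p.2 -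
      2 * Complex.I * a.1 / p.1.im) = a.1 / (D * p.1.im) *
        (2 * Complex.I * (D - E) + 4 * (A 1 0 : ℝ) * p.1.im) := by
    field_simp
    ring
  have h0 : 2 * Complex.I * (D - E) + 4 * (A 1 0 : ℝ) * p.1.im = 0 := by
    rw [h]
    linear_combination 4 * ((A 1 0 : ℝ) : ℂ) * p.1.im * Complex.I_mul_I
  rw [h0, mul_zero] at e
  exact sub_eq_zero.1 e

theorem im_conj_mul_slDiff (A : SL2R) {p : ℂ × ℂ} (hp : p ∈ dom) (a b : ℂ × ℂ) :
    (conj (slDiff A p a).1 * (slDiff A p b).1).im / (slAct A p).1.im ^ 2 =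
      (conj a.1 * b.1).im / p.1.im ^ 2 := by
  have hD := autFactor_ne_zero A hp.1
  have hy := ne_of_gt hp.1
  have hN : Complex.normSq (autFactor A p.1) ≠ 0 := (Complex.normSq_pos.2 hD).ne'
  have h : conj (slDiff A p a).1 * (slDiff A p b).1 =
      (((Complex.normSq (autFactor A p.1) ^ 2)⁻¹ : ℝ) : ℂ) * (conj a.1 * b.1) := by
    push_cast
    rw [Complex.normSq_eq_conj_mul_self]
    simp only [slDiff, map_div₀, map_pow]
    have hD' : conj (autFactor A p.1) ≠ 0 := by simpa using hD
    field_simp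
  rw [h, Complex.im_ofReal_mul, slAct_fst_im]
  field_simp

theorem preservesOn_omegaForm_slAct (f : ℝ → ℝ) (A : SL2R) :
    PreservesOn dom (omegaForm f) (slAct A) := by
  intro p hp a b
  rw [fderiv_slAct A hp, fderiv_slAct A hp]
  exact omegaForm_congr f hp (slAct_mem_dom A hp) (fibreNorm_slAct A hp) (logDiff_slAct A hp a)
    (logDiff_slAct A hp b) (im_conj_mul_slDiff A hp a b)

theorem contDiffOn_slAct (A : SL2R) : ContDiffOn ℝ ∞ (slAct A) dom := by
  have h1 : ContDiff ℝ ∞ (fun p : ℂ × ℂ => autFactor A p.1) :=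
    (contDiff_const.mul contDiff_fst).add contDiff_const
  have h2 : ContDiff ℝ ∞ (fun p : ℂ × ℂ => ((A 0 0 : ℝ) * p.1 + (A 0 1 : ℝ) : ℂ)) :=
    (contDiff_const.mul contDiff_fst).add contDiff_const
  exact (h2.contDiffOn.mul (h1.contDiffOn.inv fun p hp => autFactor_ne_zero A hp.1)).prodMk
    ((h1.pow 4).mul contDiff_snd).contDiffOn

/-! ### The moment map of the action of `PSL(2,ℝ)` -/

theorem pslMoment_apply (f : ℝ → ℝ) {p : ℂ × ℂ} (hp : p ∈ dom) (X : LieSL2R) :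
    pslMoment f p X = (1 - f (fibreNorm p)) * Matrix.trace (jCoord p * (X : Mat2)) := by
  rw [← halfNormSq_eq hp]
  rfl

theorem lieSL2R_apply (X : LieSL2R) : (X : Mat2) 1 1 = -(X : Mat2) 0 0 := by
  have h : Matrix.trace (X : Mat2) = 0 := X.2
  rw [Matrix.trace_fin_two] at h
  linarith

theorem trace_jCoord_mul {p : ℂ × ℂ} (X : LieSL2R) :
    Matrix.trace (jCoord p * (X : Mat2)) = 2 * (X : Mat2) 0 0 * ratio p +
      (X : Mat2) 0 1 / p.1.im - (X : Mat2) 1 0 * ((p.1.re ^ 2 + p.1.im ^ 2) / p.1.im) := by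
  have h := lieSL2R_apply X
  rw [Matrix.trace_fin_two, Matrix.mul_apply, Matrix.mul_apply]
  simp [Fin.sum_univ_two, jCoord, h, ratio]
  ring

theorem pslMoment_diagElement (f : ℝ → ℝ) {p : ℂ × ℂ} (hp : p ∈ dom) :
    H₂ f p = pslMoment f p diagElement := by
  rw [pslMoment_apply f hp, trace_jCoord_mul, H₂_eq]
  simp [diagElement]
  ring

theorem contDiffOn_trace (X : LieSL2R) :
    ContDiffOn ℝ ∞ (fun p => Matrix.trace (jCoord p * (X : Mat2))) dom := by
  simp only [trace_jCoord_mul]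
  have h1 := contDiffOn_div_im (g := fun _ => (X : Mat2) 0 1) contDiffOn_const 1
  have h2 := contDiffOn_div_im (g := fun p => p.1.re ^ 2 + p.1.im ^ 2)
    ((contDiff_re.pow 2).add (contDiff_im.pow 2)).contDiffOn 1
  simp only [pow_one] at h1 h2
  exact ((contDiffOn_const.mul contDiffOn_ratio).add h1).sub (contDiffOn_const.mul h2)

theorem fderiv_trace {p : ℂ × ℂ} (hp : p ∈ dom) (X : LieSL2R) (v : ℂ × ℂ) :
    fderiv ℝ (fun p => Matrix.trace (jCoord p * (X : Mat2))) p v =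
      2 * (X : Mat2) 0 0 * ratioDiff p v - (X : Mat2) 0 1 * v.1.im / p.1.im ^ 2 -
      (X : Mat2) 1 0 * (2 * p.1.re * v.1.re / p.1.im - p.1.re ^ 2 * v.1.im / p.1.im ^ 2 +
        v.1.im) := by
  simp only [trace_jCoord_mul]
  obtain ⟨M, hM, hM'⟩ := hasFDerivAt_ratio hp
  have hy : p.1.im ≠ 0 := ne_of_gt hp.1
  have h1 := HasFDerivAt.real_div (hasFDerivAt_const ((X : Mat2) 0 1) p) (hasFDerivAt_im p) hy
  have h2 := HasFDerivAt.real_div (((hasFDerivAt_re p).pow 2).fun_add ((hasFDerivAt_im p).pow 2))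
    (hasFDerivAt_im p) hy
  rw [(((hM.const_mul (2 * (X : Mat2) 0 0)).fun_add h1).fun_sub
    (h2.const_mul ((X : Mat2) 1 0))).fderiv]
  simp [hM']
  field_simp
  ring

/-- The vector field on `ℍ² × ℂ*` generated by an element of `𝔰𝔩(2,ℝ)`. -/
def slField (X : LieSL2R) (p : ℂ × ℂ) : ℂ × ℂ :=
  ((X : Mat2) 0 1 + 2 * (X : Mat2) 0 0 * p.1 - (X : Mat2) 1 0 * p.1 ^ 2,
    4 * ((X : Mat2) 1 0 * p.1 - (X : Mat2) 0 0) * p.2)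

theorem logDiff_slField (X : LieSL2R) {p : ℂ × ℂ} (hp : p ∈ dom) :
    logDiff p (slField X p) =
      ((-2 * Matrix.trace (jCoord p * (X : Mat2)) : ℝ) : ℂ) * Complex.I := by
  have hy : p.1.im ≠ 0 := ne_of_gt hp.1
  have hw : (slField X p).2 / p.2 = 4 * ((X : Mat2) 1 0 * p.1 - (X : Mat2) 0 0) :=
    mul_div_cancel_right₀ _ hp.2
  rw [trace_jCoord_mul]
  apply Complex.ext
  · rw [re_logDiff, hw]
    simp [slField, sq]
    field_simp
    ring
  · rw [im_logDiff, hw]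
    simp [slField, sq, ratio]
    field_simp
    ring

/-- The hyperbolic term of `Ω_f` contributes `(1 - f) d tr(JX)`. As `ζ = -2i tr(JX)` on the
generator, the other term contributes `tr(JX) d(1 - f)`. -/
theorem fderiv_pslMoment {f : ℝ → ℝ} (hf : ContDiffOn ℝ ∞ f (Set.Ici 0)) (X : LieSL2R)
    {p : ℂ × ℂ} (hp : p ∈ dom) (v : ℂ × ℂ) :
    fderiv ℝ (fun q => pslMoment f q X) p v = omegaForm f p (slField X p) v := by
  have hy : p.1.im ≠ 0 := ne_of_gt hp.1
  obtain ⟨L, hL, hL'⟩ := hasFDerivAt_profile_fibreNorm hf hp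
  have hd : DifferentiableAt ℝ (fun p => Matrix.trace (jCoord p * (X : Mat2))) p :=
    ((contDiffOn_trace X).contDiffAt (isOpen_dom.mem_nhds hp)).differentiableAt (by simp)
  have h : (fun q => pslMoment f q X) =ᶠ[nhds p]
      fun q => (1 - f (fibreNorm q)) * Matrix.trace (jCoord q * (X : Mat2)) := by
    filter_upwards [isOpen_dom.mem_nhds hp] with q hq
    exact pslMoment_apply f hq X
  rw [h.fderiv_eq, ((hL.const_sub 1).fun_mul hd.hasFDerivAt).fderiv]
  simp only [_root_.add_apply, _root_.smul_apply, _root_.neg_apply, smul_eq_mul, hL',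
    fderiv_trace hp, omegaForm_eq_fibreNorm f hp, logDiff_slField X hp]
  generalize derivWithin f (Set.Ici 0) (fibreNorm p) = F'
  generalize Matrix.trace (jCoord p * (X : Mat2)) = τ
  generalize logDiff p v = ζ
  simp [slField, sq, ratioDiff]
  field_simp
  ring

section MatrixExp

attribute [local instance] Matrix.linftyOpNormedRing Matrix.linftyOpNormedAlgebra

theorem hasDerivAt_exp_smul_apply (X : Mat2) (i j : Fin 2) :
    HasDerivAt (fun t : ℝ => NormedSpace.exp (t • X) i j) (X i j) 0 := by
  have h := hasDerivAt_exp_smul_const (𝕂 := ℝ) X (0 : ℝ)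
  rw [zero_smul, NormedSpace.exp_zero, one_mul] at h
  exact hasDerivAt_pi.1 (hasDerivAt_pi.1 h i) j

end MatrixExp

theorem hasDerivAt_pslAct (X : LieSL2R) {p : ℂ × ℂ} :
    HasDerivAt (fun t : ℝ => pslAct (pslExp (t • X)) p) (slField X p) 0 := by
  have h := fun i j => (hasDerivAt_exp_smul_apply (X : Mat2) i j).ofReal_comp
  have h00 := ((h 0 0).mul_const p.1).fun_add (h 0 1)
  have h10 := ((h 1 0).mul_const p.1).fun_add (h 1 1)
  have hX := lieSL2R_apply X
  -- At `t = 0` the denominator `cz + d` equals `1`, so `p` need not lie in `dom`.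
  have h2 := (h00.fun_div h10 (by simp)).prodMk ((h10.fun_pow 4).mul_const p.2)
  refine HasDerivAt.congr_deriv (f' := _) h2 ?_
  refine Prod.ext ?_ ?_
  · simp [hX, slField]
    ring
  · simp [hX, slField, sub_eq_add_neg]

theorem isHamiltonianAction_pslAct {f : ℝ → ℝ} (hf : ContDiffOn ℝ ∞ f (Set.Ici 0)) :
    IsHamiltonianAction pslExp pslAd dom (omegaForm f) pslAct (pslMoment f) where
  mapsTo g := by
    induction g using QuotientGroup.induction_on with
    | H A => exact fun _ hp => slAct_mem_dom A hp
  one_act p _ := one_slAct p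
  mul_act g h p hp := by
    induction g using QuotientGroup.induction_on with
    | H A =>
      induction h using QuotientGroup.induction_on with
      | H B => exact slAct_mul A B hp
  smooth_act g := by
    induction g using QuotientGroup.induction_on with
    | H A => exact contDiffOn_slAct A
  symplectic g := by
    induction g using QuotientGroup.induction_on with
    | H A => exact preservesOn_omegaForm_slAct f A
  smooth_moment X :=
    ((contDiffOn_const.sub (contDiffOn_profile_fibreNorm hf)).mul (contDiffOn_trace X)).congr
      fun _ hp => pslMoment_apply f hp X
  equivariant g p hp X := by
    induction g using QuotientGroup.induction_on with
    | H A =>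
      change pslMoment f (slAct A p) X = pslMoment f p (slAd A⁻¹ X)
      rw [pslMoment_apply f hp, pslMoment_apply f (slAct_mem_dom A hp), fibreNorm_slAct A hp,
        jCoord_slAct A hp.1]
      congr 1
      simp only [slAd, inv_inv]
      rw [Matrix.mul_assoc, Matrix.mul_assoc, Matrix.trace_mul_comm, Matrix.mul_assoc,
        Matrix.mul_assoc]
  generator X p hp := ⟨slField X p, hasDerivAt_pslAct X, fun v => fderiv_pslMoment hf X hp v⟩

/-! ### Angle coordinates -/

/-- The angle `arg w - 2 x / y`, as a point of the circle. -/
def angle₁ (p : ℂ × ℂ) : Circle := Circle.exp (Complex.arg p.2 - 2 * ratio p)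

/-- The angle `(log y) / 2`. -/
def angle₂ (p : ℂ × ℂ) : ℝ := Real.log p.1.im / 2

/-- A real-valued lift of the angle `angle₁` near the point `p`, up to an additive constant. -/
def localAngle (p q : ℂ × ℂ) : ℝ := (Complex.log (q.2 / p.2)).im - 2 * ratio q

/-- `exp(i arg w) = w/|w|` is multiplicative, so the jump of `arg` disappears and the formula holds
on all of `dom`. -/
theorem coe_angle₁ {p q : ℂ × ℂ} (hp : p ∈ dom) (hq : q ∈ dom) :
    (angle₁ q : ℂ) =
      Complex.exp (Complex.arg p.2 * Complex.I) * Complex.exp (localAngle p q * Complex.I) := by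
  have hn : ∀ z : ℂ, z ≠ 0 → Complex.exp (Complex.arg z * Complex.I) = z / ‖z‖ := by
    intro z hz
    have h := Complex.norm_mul_exp_arg_mul_I z
    have h0 : (‖z‖ : ℂ) ≠ 0 := by exact_mod_cast norm_ne_zero_iff.2 hz
    rw [eq_div_iff h0, mul_comm, h]
  have hp0 : (‖p.2‖ : ℂ) ≠ 0 := by exact_mod_cast norm_ne_zero_iff.2 hp.2
  have hq0 : (‖q.2‖ : ℂ) ≠ 0 := by exact_mod_cast norm_ne_zero_iff.2 hq.2
  have hp1 := hp.2
  rw [angle₁, Circle.coe_exp, localAngle, Complex.log_im]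
  push_cast
  rw [sub_mul, sub_mul, Complex.exp_sub, Complex.exp_sub, hn _ hp.2, hn _ hq.2,
    hn _ (div_ne_zero hq.2 hp.2), norm_div]
  push_cast
  field_simp

/-- For `q` near `p` the quotient `q.2 / p.2` is close to `1`, where the principal logarithm is
smooth. -/
theorem eventually_localAngle {p : ℂ × ℂ} (hp : p ∈ dom) :
    ∀ᶠ q in nhds p, q ∈ dom ∧ ContDiffAt ℝ ∞ (localAngle p) q ∧
      ∀ v, fderiv ℝ (localAngle p) q v = (v.2 / q.2).im - 2 * ratioDiff q v := by
  have hc : ContinuousAt (fun q : ℂ × ℂ => q.2 / p.2) p :=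
    (continuous_snd.div_const _).continuousAt
  have hs : Complex.slitPlane ∈ nhds (p.2 / p.2) := by
    rw [div_self hp.2]
    exact Complex.isOpen_slitPlane.mem_nhds Complex.one_mem_slitPlane
  filter_upwards [isOpen_dom.mem_nhds hp, hc hs] with q hq hslit
  have hslit : q.2 / p.2 ∈ Complex.slitPlane := hslit
  refine ⟨hq, ?_, fun v => ?_⟩
  · have h1 : ContDiffAt ℝ ∞ (fun q : ℂ × ℂ => Complex.log (q.2 / p.2)) q :=
      ((Complex.contDiffAt_log (n := ∞) hslit).restrict_scalars ℝ).comp q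
        (contDiff_snd.div_const _).contDiffAt
    exact (Complex.imCLM.contDiff.contDiffAt.comp q h1).sub
      (contDiffAt_const.mul (contDiffOn_ratio.contDiffAt (isOpen_dom.mem_nhds hq)))
  · obtain ⟨M, hM, hM'⟩ := hasFDerivAt_ratio hq
    have h0 : HasFDerivAt (𝕜 := ℂ) (fun q : ℂ × ℂ => q.2 / p.2) _ q :=
      ((hasDerivAt_id q.2).div_const p.2).comp_hasFDerivAt q
        (ContinuousLinearMap.snd ℂ ℂ ℂ).hasFDerivAt
    have h1 := Complex.imCLM.hasFDerivAt.comp q ((h0.clog hslit).restrictScalars ℝ)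
    have h2 : HasFDerivAt (localAngle p) _ q := h1.sub (hM.const_mul 2)
    rw [h2.fderiv]
    have hp2 := hp.2
    have hq2 := hq.2
    have e : (q.2 / p.2)⁻¹ * (1 / p.2 * v.2) = v.2 / q.2 := by field_simp
    change ((q.2 / p.2)⁻¹ * (1 / p.2 * v.2)).im - 2 * M v = _
    rw [e, hM']

theorem dAngle_angle₁ {p : ℂ × ℂ} (hp : p ∈ dom) (v : ℂ × ℂ) :
    dAngle angle₁ p v = (v.2 / p.2).im - 2 * ratioDiff p v := by
  obtain ⟨-, hg, hg'⟩ := (eventually_localAngle hp).self_of_nhds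
  have h : (fun q => (angle₁ q : ℂ)) =ᶠ[nhds p] fun q =>
      Complex.exp (Complex.arg p.2 * Complex.I) * Complex.exp (localAngle p q * Complex.I) := by
    filter_upwards [isOpen_dom.mem_nhds hp] with q hq
    exact coe_angle₁ hp hq
  have h1 := (Complex.ofRealCLM.hasFDerivAt.comp p (hg.differentiableAt (by simp)).hasFDerivAt)
  have h2 : HasFDerivAt (fun q => Complex.exp (Complex.arg p.2 * Complex.I) *
    Complex.exp (localAngle p q * Complex.I)) _ p := ((h1.mul_const Complex.I).cexp).const_mul _
  rw [dAngle, h.fderiv_eq, h2.fderiv, ← hg']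
  -- For `e = exp(iθ)` of modulus one, `ē de` reduces to `i dθ`.
  have e : (conj (angle₁ p : ℂ)) * (angle₁ p : ℂ) = 1 := by
    rw [← Complex.normSq_eq_conj_mul_self, Circle.normSq_coe, Complex.ofReal_one]
  have e2 := coe_angle₁ hp hp
  have e3 : (conj (angle₁ p : ℂ)) * (Complex.exp (Complex.arg p.2 * Complex.I) *
      (Complex.exp (localAngle p p * Complex.I) *
        (Complex.I * (fderiv ℝ (localAngle p) p v : ℝ)))) =
      Complex.I * (fderiv ℝ (localAngle p) p v : ℝ) := by
    rw [e2] at e ⊢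
    linear_combination (Complex.I * (fderiv ℝ (localAngle p) p v : ℝ)) * e
  have e4 := congrArg Complex.im e3
  rw [Complex.I_mul_im, Complex.ofReal_re] at e4
  simpa using e4

theorem contDiffOn_angle₁ : ContDiffOn ℝ ∞ (fun p => (angle₁ p : ℂ)) dom := by
  intro p hp
  obtain ⟨-, hg, -⟩ := (eventually_localAngle hp).self_of_nhds
  have h : (fun q => (angle₁ q : ℂ)) =ᶠ[nhds p] fun q =>
      Complex.exp (Complex.arg p.2 * Complex.I) * Complex.exp (localAngle p q * Complex.I) := by
    filter_upwards [isOpen_dom.mem_nhds hp] with q hq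
    exact coe_angle₁ hp hq
  refine ContDiffAt.contDiffWithinAt (ContDiffAt.congr_of_eventuallyEq ?_ h)
  exact contDiffAt_const.mul
    (((Complex.ofRealCLM.contDiff.contDiffAt.comp p hg).mul contDiffAt_const).cexp)

theorem contDiffOn_angle₂ : ContDiffOn ℝ ∞ angle₂ dom :=
  (contDiff_im.contDiffOn.log fun _ hp => ne_of_gt hp.1).div_const 2

theorem fderiv_angle₂ {p : ℂ × ℂ} (hp : p ∈ dom) (v : ℂ × ℂ) :
    fderiv ℝ angle₂ p v = v.1.im / (2 * p.1.im) := by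
  have h : HasFDerivAt (fun q : ℂ × ℂ => Real.log q.1.im * 2⁻¹) _ p :=
    ((hasFDerivAt_im p).log (ne_of_gt hp.1)).mul_const 2⁻¹
  have h' : angle₂ = fun q : ℂ × ℂ => Real.log q.1.im * 2⁻¹ := by
    funext q
    rw [angle₂, div_eq_mul_inv]
  rw [h', h.fderiv]
  simp
  ring

section Darboux

variable {f : ℝ → ℝ} (hf : ContDiffOn ℝ ∞ f (Set.Ici 0)) (hf0 : f 0 = 0)
  (hf' : ∀ t : ℝ, 0 ≤ t → derivWithin f (Set.Ici 0) t < 0)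

include hf

theorem omegaForm_eq_darboux {p : ℂ × ℂ} (hp : p ∈ dom) (a b : ℂ × ℂ) :
    omegaForm f p a b =
      (dAngle angle₁ p a * fderiv ℝ (H₁ f) p b - dAngle angle₁ p b * fderiv ℝ (H₁ f) p a) +
      (fderiv ℝ angle₂ p a * fderiv ℝ (H₂ f) p b - fderiv ℝ angle₂ p b * fderiv ℝ (H₂ f) p a) := by
  have hy : p.1.im ≠ 0 := ne_of_gt hp.1
  rw [omegaForm_eq_fibreNorm f hp, dAngle_angle₁ hp, dAngle_angle₁ hp, fderiv_H₁ hf hp,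
    fderiv_H₁ hf hp, fderiv_H₂ hf hp, fderiv_H₂ hf hp, fderiv_angle₂ hp, fderiv_angle₂ hp]
  simp only [Complex.mul_im, Complex.conj_re, Complex.conj_im, re_logDiff, im_logDiff]
  generalize derivWithin f (Set.Ici 0) (fibreNorm p) = F'
  generalize f (fibreNorm p) = F
  generalize fibreNorm p = s
  simp only [ratioDiff, ratio]
  field_simp
  ring

include hf0 hf'

theorem darboux_independent {p : ℂ × ℂ} (hp : p ∈ dom) {v : ℂ × ℂ}
    (h1 : dAngle angle₁ p v = 0) (h2 : fderiv ℝ (H₁ f) p v = 0) (h3 : fderiv ℝ angle₂ p v = 0)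
    (h4 : fderiv ℝ (H₂ f) p v = 0) : v = 0 := by
  have hy : p.1.im ≠ 0 := ne_of_gt hp.1
  have hs := fibreNorm_pos hp
  have hF := one_sub_profile_pos hf hf0 hf' hs
  have hF' := hf' _ hs.le
  rw [dAngle_angle₁ hp] at h1
  rw [fderiv_H₁ hf hp] at h2
  rw [fderiv_angle₂ hp] at h3
  rw [fderiv_H₂ hf hp, h2] at h4
  have hv1 : v.1.im = 0 := by simpa [hy] using h3
  have hr : ratioDiff p v = 0 := by simpa [hF.ne'] using h4
  have hv2 : v.1.re = 0 := by simpa [ratioDiff, hv1, hy] using hr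
  have h5 : (logDiff p v).re = 0 := by simpa [hF'.ne, hs.ne'] using h2
  rw [re_logDiff, hv1] at h5
  rw [hr] at h1
  have h6 : v.2 / p.2 = 0 := Complex.ext (by simpa using h5) (by simpa using h1)
  have h7 : v.2 = 0 := by simpa [hp.2] using h6
  exact Prod.ext (Complex.ext hv2 hv1) h7

theorem independent_H {p : ℂ × ℂ} (hp : p ∈ dom) {α β : ℝ}
    (h : ∀ v, α * fderiv ℝ (H₁ f) p v + β * fderiv ℝ (H₂ f) p v = 0) : α = 0 ∧ β = 0 := by
  have hy : p.1.im ≠ 0 := ne_of_gt hp.1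
  have hs := fibreNorm_pos hp
  have hF := one_sub_profile_pos hf hf0 hf' hs
  have hF' := hf' _ hs.le
  have hβ : β = 0 := by
    -- The direction `∂/∂x` changes `x/y` but not `s`; the radial direction of `w`, used next,
    -- changes `s` but not `x/y`.
    have := h (1, 0)
    rw [fderiv_H₁ hf hp, fderiv_H₂ hf hp, re_logDiff] at this
    simpa [ratioDiff, hy, hF.ne'] using this
  refine ⟨?_, hβ⟩
  have := h (0, p.2)
  rw [fderiv_H₁ hf hp, re_logDiff, hβ] at this
  simpa [div_self hp.2, hF'.ne, hs.ne'] using this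

theorem isOpen_range_H : IsOpen ((fun p => (H₁ f p, H₂ f p)) '' dom) := by
  have ho : IsOpen (f '' Set.Ioi 0) := by
    rw [isOpen_iff_mem_nhds]
    rintro _ ⟨t, ht, rfl⟩
    have h : HasStrictDerivAt f (derivWithin f (Set.Ici 0) t) t :=
      (contDiffAt_profile hf ht).hasStrictDerivAt' (hasDerivAt_profile hf ht) (by simp)
    rw [← h.map_nhds_eq (hf' t (le_of_lt ht)).ne]
    exact Filter.image_mem_map (Ioi_mem_nhds ht)
  -- For fixed `s` the ratio `x/y` is arbitrary and `1 - f ≠ 0`, so `H₂` takes every real value and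
  -- only `H₁` is constrained.
  have he : (fun p => (H₁ f p, H₂ f p)) '' dom =
      (fun x : ℝ × ℝ => 2 * x.1) ⁻¹' (f '' Set.Ioi 0) := by
    ext x
    constructor
    · rintro ⟨p, hp, rfl⟩
      exact ⟨fibreNorm p, fibreNorm_pos hp, by simp only [H₁_eq f hp]; ring⟩
    · rintro ⟨t, ht, hx⟩
      have ht' : (0 : ℝ) < t := ht
      have hF := (one_sub_profile_pos hf hf0 hf' ht').ne'
      have hp : ((⟨x.2 / (2 * (1 - f t)), 1⟩, (Real.sqrt t : ℂ)) : ℂ × ℂ) ∈ dom :=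
        ⟨one_pos, by simpa using (Real.sqrt_pos.2 ht').ne'⟩
      have hn : fibreNorm (⟨x.2 / (2 * (1 - f t)), 1⟩, (Real.sqrt t : ℂ)) = t := by
        simp [fibreNorm, Real.sq_sqrt ht'.le]
      refine ⟨_, hp, ?_⟩
      simp only [H₁_eq f hp, H₂_eq, hn, ratio]
      refine Prod.ext ?_ ?_
      · simp only [hx]
        ring
      · simp only
        field_simp
  rw [he]
  exact ho.preimage (continuous_const.mul continuous_fst)

theorem eq_of_H_eq {p q : ℂ × ℂ} (hp : p ∈ dom) (hq : q ∈ dom) (h1 : H₁ f p = H₁ f q)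
    (h2 : H₂ f p = H₂ f q) : fibreNorm p = fibreNorm q ∧ ratio p = ratio q := by
  rw [H₁_eq f hp, H₁_eq f hq] at h1
  have hs : fibreNorm p = fibreNorm q :=
    (strictAntiOn_profile hf hf').injOn (fibreNorm_pos hp).le (fibreNorm_pos hq).le (by linarith)
  refine ⟨hs, ?_⟩
  have hF := (one_sub_profile_pos hf hf0 hf' (fibreNorm_pos hq)).ne'
  rw [H₂_eq, H₂_eq, hs] at h2
  have := mul_right_cancel₀ hF h2
  linarith

theorem bijOn_darboux :
    Set.BijOn (fun p => (angle₁ p, angle₂ p, (H₁ f p, H₂ f p))) dom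
      (Set.univ ×ˢ Set.univ ×ˢ ((fun p => (H₁ f p, H₂ f p)) '' dom)) := by
  refine ⟨fun p hp => ⟨trivial, trivial, p, hp, rfl⟩, ?_, ?_⟩
  · intro p hp q hq h
    simp only [Prod.mk.injEq] at h
    obtain ⟨ha, hb, h1, h2⟩ := h
    obtain ⟨hs, hr⟩ := eq_of_H_eq hf hf0 hf' hp hq h1 h2
    have hy : p.1.im = q.1.im := by
      apply Real.log_injOn_pos hp.1 hq.1
      simp only [angle₂] at hb
      linarith
    have hq1 : q.1.im ≠ 0 := ne_of_gt hq.1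
    have hx : p.1.re = q.1.re := by
      rw [ratio, ratio, hy] at hr
      exact (div_left_inj' hq1).1 hr
    have hn : ‖p.2‖ = ‖q.2‖ := by
      rw [fibreNorm, fibreNorm, hy] at hs
      have := mul_left_cancel₀ (pow_ne_zero 4 hq1) hs
      exact (sq_eq_sq₀ (norm_nonneg _) (norm_nonneg _)).1 this
    have harg : Complex.exp (Complex.arg p.2 * Complex.I) =
        Complex.exp (Complex.arg q.2 * Complex.I) := by
      have := congrArg (fun c : Circle => (c : ℂ)) ha
      simp only [angle₁, hr, Circle.coe_exp] at this
      push_cast at this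
      rw [sub_mul, sub_mul, Complex.exp_sub, Complex.exp_sub] at this
      exact (div_left_inj' (Complex.exp_ne_zero _)).1 this
    refine Prod.ext (Complex.ext hx hy) ?_
    rw [← Complex.norm_mul_exp_arg_mul_I p.2, ← Complex.norm_mul_exp_arg_mul_I q.2, hn, harg]
  · rintro ⟨e, θ, h⟩ ⟨-, -, q, hq, hh⟩
    simp only at hh
    have hs := fibreNorm_pos hq
    -- Explicit inverse: `y` from `θ₂ = ½ log y`, `|w|` from `s = y⁴|w|²`, and `arg w` from `θ₁ +
    -- 2x/y`.
    set y : ℝ := Real.exp (2 * θ) with hy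
    have hy0 : 0 < y := Real.exp_pos _
    set r : ℝ := Real.sqrt (fibreNorm q) / y ^ 2 with hr
    have hr0 : 0 < r := by positivity
    set w : ℂ := r * (e * Circle.exp (2 * ratio q) : Circle) with hw
    have hp : ((⟨ratio q * y, y⟩, w) : ℂ × ℂ) ∈ dom :=
      ⟨hy0, mul_ne_zero (by exact_mod_cast hr0.ne') (Circle.coe_ne_zero _)⟩
    have hn : ‖w‖ = r := by
      rw [hw, norm_mul, Circle.norm_coe, mul_one, Complex.norm_real, Real.norm_of_nonneg hr0.le]
    have h1 : fibreNorm (⟨ratio q * y, y⟩, w) = fibreNorm q := by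
      rw [fibreNorm, hn, hr, div_pow, Real.sq_sqrt hs.le]
      simp only
      field_simp
    have h2 : ratio (⟨ratio q * y, y⟩, w) = ratio q := by
      simp [ratio, hy0.ne']
    refine ⟨_, hp, Prod.ext ?_ (Prod.ext ?_ ?_)⟩
    · have hcirc : Circle.exp (Complex.arg w) = e * Circle.exp (2 * ratio q) := by
        apply Circle.ext
        have h := Complex.norm_mul_exp_arg_mul_I w
        rw [hn] at h
        rw [Circle.coe_exp]
        exact mul_left_cancel₀ (by exact_mod_cast hr0.ne') (h.trans hw)
      simp only [angle₁, h2, Circle.exp_sub, hcirc, mul_div_cancel_right]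
    · simp [angle₂, hy]
    · rw [← hh]
      simp only [H₁_eq f hp, H₁_eq f hq, H₂_eq, h1, h2]

theorem isGlobalDarbouxFrame :
    IsGlobalDarbouxFrame dom (omegaForm f) angle₁ (H₁ f) angle₂ (H₂ f) where
  smooth_angle := contDiffOn_angle₁
  smooth_θ := contDiffOn_angle₂
  smooth_H₁ := contDiffOn_H₁ hf
  smooth_H₂ := contDiffOn_H₂ hf
  independent _ hp _ := darboux_independent hf hf0 hf' hp
  isOpen_base := isOpen_range_H hf hf0 hf'
  bijOn := bijOn_darboux hf hf0 hf'
  darboux _ hp := omegaForm_eq_darboux hf hp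

end Darboux

/-! ### Closedness -/

section Closed

variable {W : Type*} [NormedAddCommGroup W] [NormedSpace ℝ W]

theorem two_le_infty : (2 : WithTop ℕ∞) ≤ ∞ :=
  WithTop.coe_le_coe.2 (le_top : (2 : ℕ∞) ≤ ⊤)

theorem hasFDerivAt_fderiv_apply {g : W → ℝ} {p : W} (hg : ContDiffAt ℝ ∞ g p) (b : W) :
    HasFDerivAt (fun q => fderiv ℝ g q b)
      ((ContinuousLinearMap.apply ℝ ℝ b).comp (fderiv ℝ (fderiv ℝ g) p)) p := by
  have h : DifferentiableAt ℝ (fderiv ℝ g) p :=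
    (hg.fderiv_right (m := 1) (one_add_one_eq_two.trans_le two_le_infty)).differentiableAt (by simp)
  exact (ContinuousLinearMap.apply ℝ ℝ b).hasFDerivAt.comp p h.hasFDerivAt

/-- The two-form `dg₁ ∧ dh₁ + dg₂ ∧ dh₂` is closed. -/
theorem closed_of_eventuallyEq {Ω : W → W → W → ℝ} {g₁ h₁ g₂ h₂ : W → ℝ} {p : W}
    (hg₁ : ContDiffAt ℝ ∞ g₁ p) (hh₁ : ContDiffAt ℝ ∞ h₁ p) (hg₂ : ContDiffAt ℝ ∞ g₂ p)
    (hh₂ : ContDiffAt ℝ ∞ h₂ p)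
    (hΩ : ∀ᶠ q in nhds p, ∀ a b, Ω q a b =
      (fderiv ℝ g₁ q a * fderiv ℝ h₁ q b - fderiv ℝ g₁ q b * fderiv ℝ h₁ q a) +
      (fderiv ℝ g₂ q a * fderiv ℝ h₂ q b - fderiv ℝ g₂ q b * fderiv ℝ h₂ q a)) (a b c : W) :
    fderiv ℝ (fun q => Ω q b c) p a + fderiv ℝ (fun q => Ω q c a) p b
      + fderiv ℝ (fun q => Ω q a b) p c = 0 := by
  have key : ∀ a b c, fderiv ℝ (fun q => Ω q b c) p a =
      (fderiv ℝ (fderiv ℝ g₁) p a b * fderiv ℝ h₁ p c +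
        fderiv ℝ g₁ p b * fderiv ℝ (fderiv ℝ h₁) p a c -
        (fderiv ℝ (fderiv ℝ g₁) p a c * fderiv ℝ h₁ p b +
        fderiv ℝ g₁ p c * fderiv ℝ (fderiv ℝ h₁) p a b)) +
      (fderiv ℝ (fderiv ℝ g₂) p a b * fderiv ℝ h₂ p c +
        fderiv ℝ g₂ p b * fderiv ℝ (fderiv ℝ h₂) p a c -
        (fderiv ℝ (fderiv ℝ g₂) p a c * fderiv ℝ h₂ p b +
        fderiv ℝ g₂ p c * fderiv ℝ (fderiv ℝ h₂) p a b)) := by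
    intro a b c
    have h : (fun q => Ω q b c) =ᶠ[nhds p] fun q =>
        (fderiv ℝ g₁ q b * fderiv ℝ h₁ q c - fderiv ℝ g₁ q c * fderiv ℝ h₁ q b) +
        (fderiv ℝ g₂ q b * fderiv ℝ h₂ q c - fderiv ℝ g₂ q c * fderiv ℝ h₂ q b) := by
      filter_upwards [hΩ] with q hq
      exact hq b c
    have G₁ := hasFDerivAt_fderiv_apply hg₁
    have K₁ := hasFDerivAt_fderiv_apply hh₁
    have G₂ := hasFDerivAt_fderiv_apply hg₂
    have K₂ := hasFDerivAt_fderiv_apply hh₂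
    rw [h.fderiv_eq, ((((G₁ b).fun_mul (K₁ c)).fun_sub ((G₁ c).fun_mul (K₁ b))).fun_add
      (((G₂ b).fun_mul (K₂ c)).fun_sub ((G₂ c).fun_mul (K₂ b)))).fderiv]
    simp
    ring
  -- Symmetry of second derivatives makes the cyclic sum cancel.
  have symm : ∀ {g : W → ℝ}, ContDiffAt ℝ ∞ g p → ∀ a b,
      fderiv ℝ (fderiv ℝ g) p a b = fderiv ℝ (fderiv ℝ g) p b a := fun hg a b =>
    (hg.isSymmSndFDerivAt (by simpa using two_le_infty)).eq a b
  rw [key, key, key, symm hg₁ b a, symm hg₁ c a, symm hg₁ c b, symm hh₁ b a, symm hh₁ c a,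
    symm hh₁ c b, symm hg₂ b a, symm hg₂ c a, symm hg₂ c b, symm hh₂ b a, symm hh₂ c a,
    symm hh₂ c b]
  ring

end Closed

theorem contDiffOn_logDiff (a : ℂ × ℂ) : ContDiffOn ℝ ∞ (fun p => logDiff p a) dom := by
  have h1 : ContDiffOn ℝ ∞ (fun p : ℂ × ℂ => p.2⁻¹) dom :=
    contDiff_snd.contDiffOn.inv fun _ hp => hp.2
  have h2 : ContDiffOn ℝ ∞ (fun p : ℂ × ℂ => ((p.1.im : ℂ))⁻¹) dom :=
    (Complex.ofRealCLM.contDiff.comp contDiff_im).contDiffOn.inv fun _ hp =>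
      Complex.ofReal_ne_zero.2 (ne_of_gt hp.1)
  simp only [logDiff, div_eq_mul_inv]
  exact (contDiffOn_const.mul h1).sub (contDiffOn_const.mul h2)

/-! ### The flow of the dilations -/

/-- This is the action of `diag(√r, 1/√r)`, for which `(cz + d)⁴ = r⁻²`; the flow takes `r =
e^{2t}`. -/
theorem H_dil (f : ℝ → ℝ) {p : ℂ × ℂ} (hp : p ∈ dom) {r : ℝ} (hr : 0 < r) :
    (((r : ℂ) * p.1, ((r ^ 2)⁻¹ : ℝ) * p.2) : ℂ × ℂ) ∈ dom ∧
      H₁ f ((r : ℂ) * p.1, ((r ^ 2)⁻¹ : ℝ) * p.2) = H₁ f p ∧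
      H₂ f ((r : ℂ) * p.1, ((r ^ 2)⁻¹ : ℝ) * p.2) = H₂ f p := by
  have hd : (((r : ℂ) * p.1, ((r ^ 2)⁻¹ : ℝ) * p.2) : ℂ × ℂ) ∈ dom :=
    ⟨by simpa using mul_pos hr hp.1,
      mul_ne_zero (Complex.ofReal_ne_zero.2 (inv_ne_zero (pow_ne_zero _ hr.ne'))) hp.2⟩
  have hs : fibreNorm ((r : ℂ) * p.1, ((r ^ 2)⁻¹ : ℝ) * p.2) = fibreNorm p := by
    simp only [fibreNorm, norm_mul, Complex.norm_real, norm_inv, norm_pow,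
      Real.norm_of_nonneg hr.le, Complex.im_ofReal_mul]
    field_simp
  have hc : ratio ((r : ℂ) * p.1, ((r ^ 2)⁻¹ : ℝ) * p.2) = ratio p := by
    simp only [ratio, Complex.im_ofReal_mul, Complex.re_ofReal_mul]
    exact mul_div_mul_left _ _ hr.ne'
  exact ⟨hd, by rw [H₁_eq f hd, H₁_eq f hp, hs], by rw [H₂_eq, H₂_eq, hs, hc]⟩

theorem hasDerivAt_dil (p : ℂ × ℂ) (t : ℝ) :
    HasDerivAt (fun t : ℝ => (((Real.exp (2 * t) : ℝ) * p.1,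
      ((Real.exp (2 * t) ^ 2)⁻¹ : ℝ) * p.2) : ℂ × ℂ))
      (dilField ((Real.exp (2 * t) : ℝ) * p.1, ((Real.exp (2 * t) ^ 2)⁻¹ : ℝ) * p.2)) t := by
  have h : HasDerivAt (fun t : ℝ => Real.exp (2 * t)) (Real.exp (2 * t) * (2 * 1)) t :=
    ((hasDerivAt_id t).const_mul 2).exp
  have h2 := (h.fun_pow 2).fun_inv (pow_ne_zero 2 (Real.exp_pos _).ne')
  refine ((h.ofReal_comp.mul_const p.1).prodMk (h2.ofReal_comp.mul_const p.2)).congr_deriv ?_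
  have hE : (Real.exp (2 * t) : ℂ) ≠ 0 := Complex.ofReal_ne_zero.2 (Real.exp_pos _).ne'
  generalize Real.exp (2 * t) = E at *
  refine Prod.ext ?_ ?_
  · simp [dilField]
    ring
  · simp [dilField]
    field_simp
    ring

/-! ### Symplectic form and integrable system -/

section Main

variable {f : ℝ → ℝ} (hf : ContDiffOn ℝ ∞ f (Set.Ici 0)) (hf0 : f 0 = 0)
  (hf' : ∀ t : ℝ, 0 ≤ t → derivWithin f (Set.Ici 0) t < 0)

include hf

theorem contDiffOn_omegaForm (a b : ℂ × ℂ) : ContDiffOn ℝ ∞ (fun p => omegaForm f p a b) dom := by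
  refine ContDiffOn.congr ?_ fun p hp => omegaForm_eq_fibreNorm f hp a b
  refine (ContDiffOn.add ?_ ?_).neg
  · exact contDiffOn_div_im
      ((contDiffOn_const.sub (contDiffOn_profile_fibreNorm hf)).mul contDiffOn_const) 2
  · refine ((contDiffOn_derivWithin_fibreNorm hf).mul contDiff_fibreNorm.contDiffOn).mul ?_
    exact Complex.imCLM.contDiff.comp_contDiffOn
      (((Complex.conjCLE : ℂ →L[ℝ] ℂ).contDiff.comp_contDiffOn (contDiffOn_logDiff a)).mul
        (contDiffOn_logDiff b))

theorem closed_omegaForm {p : ℂ × ℂ} (hp : p ∈ dom) (a b c : ℂ × ℂ) :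
    fderiv ℝ (fun q => omegaForm f q b c) p a + fderiv ℝ (fun q => omegaForm f q c a) p b
      + fderiv ℝ (fun q => omegaForm f q a b) p c = 0 := by
  have hn := isOpen_dom.mem_nhds hp
  -- Closedness is local, so the circle-valued angle may be replaced by its real lift near `p`.
  refine closed_of_eventuallyEq (eventually_localAngle hp).self_of_nhds.2.1
    ((contDiffOn_H₁ hf).contDiffAt hn) (contDiffOn_angle₂.contDiffAt hn)
    ((contDiffOn_H₂ hf).contDiffAt hn) ?_ a b c
  filter_upwards [eventually_localAngle hp] with q hq a b
  obtain ⟨hq, -, hg⟩ := hq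
  rw [omegaForm_eq_darboux hf hq, dAngle_angle₁ hq, dAngle_angle₁ hq, hg, hg]

/-! ### The integrable system -/

theorem isHamiltonianVectorField_fields (i : Fin 2) :
    IsHamiltonianVectorField dom (omegaForm f) (![H₁ f, H₂ f] i)
      (![rotField, dilField] i) := by
  fin_cases i
  · exact ⟨contDiff_rotField.contDiffOn, fun p hp v => omegaForm_rotField hf hp v⟩
  · exact ⟨contDiff_dilField.contDiffOn, fun p hp v => omegaForm_dilField hf hp v⟩

theorem hasCompleteFibers : HasCompleteFibers dom (omegaForm f) ![H₁ f, H₂ f] := by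
  refine ⟨![rotField, dilField], isHamiltonianVectorField_fields hf, fun i p hp => ?_⟩
  fin_cases i
  · refine ⟨fun t => rotAct (Circle.exp t) p, by simp [rotAct], fun t =>
      ⟨rotAct_mem_dom _ hp, fun j => ?_, ?_⟩⟩
    · fin_cases j
      · exact H₁_rotAct f _ hp
      · simp only [Fin.mk_one, Matrix.cons_val_one, Matrix.cons_val_fin_one, H₂_eq,
          fibreNorm_rotAct]
        rfl
    · simpa using hasDerivAt_exp_rotAct 1 p t
  · refine ⟨fun t => ((Real.exp (2 * t) : ℝ) * p.1, ((Real.exp (2 * t) ^ 2)⁻¹ : ℝ) * p.2),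
      by simp, fun t => ?_⟩
    obtain ⟨h0, h1, h2⟩ := H_dil f hp (Real.exp_pos (2 * t))
    refine ⟨h0, fun j => ?_, hasDerivAt_dil p t⟩
    fin_cases j
    · exact h1
    · exact h2

include hf0 hf'

theorem isSymplecticOn_omegaForm : IsSymplecticOn dom (omegaForm f) where
  smooth := contDiffOn_omegaForm hf
  linear p hp b := by
    constructor
    · intro x y
      simp only [omegaForm_eq_darboux hf hp, dAngle, map_add, mul_add, Complex.add_im]
      ring
    · intro c x
      simp only [omegaForm_eq_darboux hf hp, dAngle, map_smul, mul_smul_comm, Complex.smul_im,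
        smul_eq_mul]
      ring
  antisymm p hp a b := by
    rw [omegaForm_eq_darboux hf hp, omegaForm_eq_darboux hf hp]
    ring
  nondegenerate p hp a ha := by
    have anti : ∀ a b, omegaForm f p a b = -omegaForm f p b a := fun a b => by
      rw [omegaForm_eq_darboux hf hp, omegaForm_eq_darboux hf hp]
      ring
    -- A vector `a` in the kernel pairs to zero with both Hamiltonian fields, so `dH₁(a) = dH₂(a) =
    -- 0`. Then `dθ₁(a) dH₁ + dθ₂(a) dH₂ = 0`, and independence of `dH₁, dH₂` kills the angle
    -- components.
    have h1 : fderiv ℝ (H₁ f) p a = 0 := by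
      rw [← omegaForm_rotField hf hp, anti, ha, neg_zero]
    have h2 : fderiv ℝ (H₂ f) p a = 0 := by
      rw [← omegaForm_dilField hf hp, anti, ha, neg_zero]
    obtain ⟨h3, h4⟩ := independent_H hf hf0 hf' hp (α := dAngle angle₁ p a)
      (β := fderiv ℝ angle₂ p a) fun v => by
        have := ha v
        rw [omegaForm_eq_darboux hf hp, h1, h2] at this
        linarith
    exact darboux_independent hf hf0 hf' hp h3 h1 h4 h2
  closed p hp := closed_omegaForm hf hp

theorem isCompletelyIntegrable :
    IsCompletelyIntegrable dom (omegaForm f) ![H₁ f, H₂ f] := by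
  refine ⟨?_, ?_, ?_, ![rotField, dilField], isHamiltonianVectorField_fields hf, ?_⟩
  · rw [Module.finrank_prod, Complex.finrank_real_complex]
  · intro i
    fin_cases i
    · exact contDiffOn_H₁ hf
    · exact contDiffOn_H₂ hf
  · intro p hp
    rw [Fintype.linearIndependent_iff]
    intro g hg
    have h := independent_H hf hf0 hf' hp (α := g 0) (β := g 1) fun v => by
      have := congrArg (fun L : ℂ × ℂ →L[ℝ] ℝ => L v) hg
      simpa [Fin.sum_univ_two] using this
    intro i
    fin_cases i
    · exact h.1
    · exact h.2
  · intro p hp i j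
    -- Both fields have imaginary `ζ` and the rotation field does not move `z`, so every product
    -- whose imaginary part enters `Ω_f` is real.
    fin_cases i <;> fin_cases j <;>
      simp [omegaForm_eq_fibreNorm f hp, logDiff_rotField hp, logDiff_dilField hp] <;>
      simp [rotField, dilField]
    ring_nf
    simp

end Main

end FlatMaximal

end

open FlatMaximal

theorem theoremC (f : ℝ → ℝ) (hf : ContDiffOn ℝ ∞ f (Set.Ici 0)) (hf0 : f 0 = 0)
    (hf' : ∀ t : ℝ, 0 ≤ t → derivWithin f (Set.Ici 0) t < 0) :
    IsParametrization ∧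
    IsSymplecticOn dom (omegaForm f) ∧
    IsHamiltonianAction (fun t : ℝ => Circle.exp t) (fun _ t => t) dom (omegaForm f)
      rotAct (circleMoment f) ∧
    (∀ c : Circle, PreservesOn dom (gForm f) (rotAct c)) ∧
    IsHamiltonianAction pslExp pslAd dom (omegaForm f) pslAct (pslMoment f) ∧
    (∀ p ∈ dom, FlatMaximal.H₁ f p = f (p.1.im ^ 4 * ‖p.2‖ ^ 2) / 2) ∧
    (∀ p ∈ dom, FlatMaximal.H₂ f p = pslMoment f p diagElement) ∧
    IsCompletelyIntegrable dom (omegaForm f) ![FlatMaximal.H₁ f, FlatMaximal.H₂ f] ∧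
    HasCompleteFibers dom (omegaForm f) ![FlatMaximal.H₁ f, FlatMaximal.H₂ f] ∧
    ∃ (e₁ : ℂ × ℂ → Circle) (θ₂ : ℂ × ℂ → ℝ),
      IsGlobalDarbouxFrame dom (omegaForm f) e₁ (FlatMaximal.H₁ f) θ₂ (FlatMaximal.H₂ f) :=
  ⟨isParametrization, isSymplecticOn_omegaForm hf hf0 hf', isHamiltonianAction_rotAct hf,
    preservesOn_gForm_rotAct f, isHamiltonianAction_pslAct hf, fun _ hp => H₁_eq f hp,
    fun _ hp => pslMoment_diagElement f hp, isCompletelyIntegrable hf hf0 hf',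
    hasCompleteFibers hf, angle₁, angle₂, isGlobalDarbouxFrame hf hf0 hf'⟩
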